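/- Let $\mathrm{Homeo}_+(\mathbf R)$ be the group of increasing self-homeomorphisms of $\mathbf R$, let $\mathbf Q_2$ be the set of dyadic rationals $p/2^q$ ($p,q\in\mathbf Z$), and let $GA(\mathbf Q_2)$ be the group of maps $x\mapsto 2^n x+p/2^q$ with $n,p,q\in\mathbf Z$. Let $PL_2(\mathbf R)$ be the group of all $h\in \mathrm{Homeo}_+(\mathbf R)$ for which there is a locally finite set $B\subset\mathbf Q_2$ such that $h$ agrees with an element of $GA(\mathbf Q_2)$ on every compact interval whose interior does not meet $B$. Let $F$ be Thompson's group of piecewise linear increasing homeomorphisms of $[0,1]$ with finitely many pieces, slopes integral powers of $2$ and break points in $\mathbf Q_2$; regard $F$ as a subgroup of $PL_2(\mathbf R)$ by letting its elements act as the identity outside $[0,1]$. For $1\le r\le\infty$ let $\mathrm{Diff}^r([0,1])$ be the group of increasing homeomorphisms of $[0,1]$ that are of class $C^r$ on $[0,1]$ together with their inverses. Write $T_p(x)=x+p$. **(1)** Let $f\in\mathrm{Homeo}_+(\mathbf R)$ be a $C^\infty$ diffeomorphism with $f(x+1)=f(x)+2$ for all $x$, $f(0)=0$, $f'(0)=1$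 and $f^{(k)}(0)=0$ for all $k\ge 2$, and let $z\in(0,1)$ satisfy $f(z)=z$ and $f'(z)>1$. Put $C=\log f'(z)$. For $r=p/2^q\in\mathbf Q_2$ put $\overline r=f^{-q}T_pf^q(0)$, and for $\gamma\in GA(\mathbf Q_2)$, $\gamma(x)=2^nx+p/2^q$, put $\theta_f(\gamma)=(f^{-q}T_pf^q)f^n$. Then there is a unique map $\theta_f$ from $PL_2(\mathbf R)$ to $\mathrm{Homeo}_+(\mathbf R)$ such that $\theta_f(h)=\theta_f(\gamma)$ on $[\overline a,\overline b)$ whenever $a<b$ are in $\mathbf Q_2$, $\gamma\in GA(\mathbf Q_2)$ and $h=\gamma$ on $[a,b]$; it is an injective group homomorphism, and it extends $\theta_f$ on $GA(\mathbf Q_2)$. Restricting $\theta_f(h)$ to $[0,1]$ for $h\in F$ gives an injective homomorphism $F\to\mathrm{Diff}^\infty([0,1])$. Every $g$ in its image satisfies $g'(0)=g'(1)=1$, and for the image $g$ of any $h\ne 1$ in $F$ there is $t\in[0,1]$ with $|\log g'(t)|\ge C$. **(2)** Consequently, for every $r$ with $1\le r\le\infty$ (an integer or $\infty$) and every $C>0$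 there is an injective homomorphism $\varphi:F\to\mathrm{Diff}^r([0,1])$ such that for all $g\ne h$ in $F$ there is $t\in[0,1]$ with $|\log(\varphi(g)'(t))-\log(\varphi(h)'(t))|\ge C$. -/

import Mathlib

open Set
open scoped ContDiff

/-- The dyadic rationals, as real numbers `p / 2 ^ q` with `p q : ℤ`. -/
def IsDyadic (x : ℝ) : Prop := ∃ p q : ℤ, x = (p : ℝ) / (2 : ℝ) ^ q

theorem IsDyadic.zero : IsDyadic 0 := ⟨0, 0, by simp⟩

theorem IsDyadic.add {x y : ℝ} (hx : IsDyadic x) (hy : IsDyadic y) : IsDyadic (x + y) := by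
  obtain ⟨p, q, rfl⟩ := hx
  obtain ⟨p', q', rfl⟩ := hy
  have key : ∀ (p q p' q' : ℤ), q ≤ q' →
      IsDyadic ((p : ℝ) / (2 : ℝ) ^ q + (p' : ℝ) / (2 : ℝ) ^ q') := by
    intro p q p' q' hq
    refine ⟨p * 2 ^ (q' - q).toNat + p', q', ?_⟩
    have h2 : (2 : ℝ) ^ q' = 2 ^ (q' - q).toNat * 2 ^ q := by
      rw [← zpow_natCast, Int.toNat_of_nonneg (by omega), ← zpow_add₀ (by norm_num)]
      congr 1
      ring
    have hq0 : (2 : ℝ) ^ q ≠ 0 := by positivity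
    push_cast
    rw [h2]
    field_simp
  rcases le_total q q' with h | h
  · exact key p q p' q' h
  · rw [add_comm]
    exact key p' q' p q h

theorem IsDyadic.neg {x : ℝ} (hx : IsDyadic x) : IsDyadic (-x) := by
  obtain ⟨p, q, rfl⟩ := hx
  exact ⟨-p, q, by push_cast; ring⟩

theorem IsDyadic.sub {x y : ℝ} (hx : IsDyadic x) (hy : IsDyadic y) : IsDyadic (x - y) := by
  rw [sub_eq_add_neg]
  exact hx.add hy.neg

theorem IsDyadic.zpow_mul {x : ℝ} (hx : IsDyadic x) (n : ℤ) : IsDyadic ((2 : ℝ) ^ n * x) := by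
  obtain ⟨p, q, rfl⟩ := hx
  refine ⟨p, q - n, ?_⟩
  rw [zpow_sub₀ (by norm_num)]
  have h1 : (2 : ℝ) ^ q ≠ 0 := by positivity
  have h2 : (2 : ℝ) ^ n ≠ 0 := by positivity
  field_simp

theorem isDyadic_zpow_mul_iff {x : ℝ} (n : ℤ) : IsDyadic ((2 : ℝ) ^ n * x) ↔ IsDyadic x := by
  refine ⟨fun h => ?_, fun h => h.zpow_mul n⟩
  have h' := h.zpow_mul (-n)
  rwa [← mul_assoc, ← zpow_add₀ (by norm_num), neg_add_cancel, zpow_zero, one_mul] at h'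

/-- `Homeo₊(ℝ)`: the increasing self-homeomorphisms of `ℝ` are exactly the order isomorphisms
`ℝ ≃o ℝ`. The group operation is composition, `(g * h) x = g (h x)`. -/
abbrev HomeoPlus : Type := ℝ ≃o ℝ

/-- The translation `T_r : x ↦ x + r`. -/
def translation (r : ℝ) : HomeoPlus := OrderIso.addRight r

/-- The group `GA(ℚ₂)` of the maps `x ↦ 2 ^ n * x + r` with `n ∈ ℤ` and `r` dyadic. -/
def dyadicAffineGroup : Subgroup HomeoPlus where
  carrier := {g | ∃ (n : ℤ) (r : ℝ), IsDyadic r ∧ ∀ x, g x = (2 : ℝ) ^ n * x + r}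
  one_mem' := ⟨0, 0, IsDyadic.zero, fun x => by simp⟩
  mul_mem' := by
    rintro g h ⟨n, r, hr, hg⟩ ⟨m, s, hs, hh⟩
    refine ⟨n + m, (2 : ℝ) ^ n * s + r, (hs.zpow_mul n).add hr, fun x => ?_⟩
    rw [RelIso.mul_apply, hg, hh, zpow_add₀ (by norm_num)]
    ring
  inv_mem' := by
    rintro g ⟨n, r, hr, hg⟩
    refine ⟨-n, -((2 : ℝ) ^ (-n) * r), (hr.zpow_mul (-n)).neg, fun x => ?_⟩
    apply g.injective
    rw [RelIso.apply_inv_self, hg, zpow_neg]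
    have h2 : (2 : ℝ) ^ n ≠ 0 := by positivity
    field_simp
    ring

theorem dyadicAffineGroup_isDyadic_iff {γ : HomeoPlus} (hγ : γ ∈ dyadicAffineGroup) (x : ℝ) :
    IsDyadic (γ x) ↔ IsDyadic x := by
  obtain ⟨n, r, hr, h⟩ := hγ
  rw [h, ← isDyadic_zpow_mul_iff (x := x) n]
  refine ⟨fun h1 => ?_, fun h1 => h1.add hr⟩
  have := h1.sub hr
  rwa [add_sub_cancel_right] at this

/-- `h` is piecewise `GA(ℚ₂)` with dyadic break points: there is a locally finite set `B` of
dyadic rationals such that `h` agrees with an element of `GA(ℚ₂)` on each compact interval whose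
interior does not meet `B`. -/
def IsPiecewiseDyadic (h : HomeoPlus) : Prop :=
  ∃ B : Set ℝ, (∀ b ∈ B, IsDyadic b) ∧ (∀ a b : ℝ, (B ∩ Icc a b).Finite) ∧
    ∀ a b : ℝ, a < b → Disjoint (Ioo a b) B → ∃ γ ∈ dyadicAffineGroup, EqOn h γ (Icc a b)

theorem exists_gap_right {B : Set ℝ} (hB : ∀ a b : ℝ, (B ∩ Icc a b).Finite) (t : ℝ) :
    ∃ u, t < u ∧ Disjoint (Ioo t u) B := by
  have hfin : ((B ∩ Icc t (t + 1)) \ {t}).Finite := (hB t (t + 1)).subset sdiff_subset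
  have hn : ((B ∩ Icc t (t + 1)) \ {t})ᶜ ∈ nhds t :=
    hfin.isClosed.isOpen_compl.mem_nhds (by simp)
  obtain ⟨ε, hε, hball⟩ := Metric.mem_nhds_iff.1 hn
  refine ⟨t + min ε 1, by have := lt_min hε one_pos; linarith, ?_⟩
  rw [Set.disjoint_left]
  rintro x ⟨h1, h2⟩ hx
  have hmε := min_le_left ε 1
  have hm1 := min_le_right ε 1
  have hxb : x ∈ Metric.ball t ε := by
    rw [Metric.mem_ball, Real.dist_eq, abs_lt]
    constructor <;> linarith
  exact hball hxb ⟨⟨hx, h1.le, by linarith⟩, fun h => h1.ne' h⟩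

theorem IsPiecewiseDyadic.isDyadic_iff {h : HomeoPlus} (hh : IsPiecewiseDyadic h) (t : ℝ) :
    IsDyadic (h t) ↔ IsDyadic t := by
  obtain ⟨B, -, hfin, hB⟩ := hh
  obtain ⟨u, htu, hu⟩ := exists_gap_right hfin t
  obtain ⟨γ, hγ, he⟩ := hB t u htu hu
  rw [he ⟨le_rfl, htu.le⟩, dyadicAffineGroup_isDyadic_iff hγ]

/-- The group `PL₂(ℝ)`. -/
def PL2 : Subgroup HomeoPlus where
  carrier := {h | IsPiecewiseDyadic h}
  one_mem' := ⟨∅, by simp, by simp, fun a b _ _ =>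
    ⟨1, dyadicAffineGroup.one_mem, fun x _ => rfl⟩⟩
  mul_mem' := by
    rintro h₁ h₂ ⟨B₁, hd₁, hf₁, hB₁⟩ hh₂
    have hdy := IsPiecewiseDyadic.isDyadic_iff hh₂
    obtain ⟨B₂, hd₂, hf₂, hB₂⟩ := hh₂
    refine ⟨B₂ ∪ h₂ ⁻¹' B₁, ?_, ?_, ?_⟩
    · rintro b (hb | hb)
      · exact hd₂ b hb
      · exact (hdy b).1 (hd₁ _ hb)
    · intro a b
      rw [union_inter_distrib_right]
      refine (hf₂ a b).union ?_
      refine ((hf₁ (h₂ a) (h₂ b)).preimage h₂.injective.injOn).subset ?_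
      rintro x ⟨hx, hxa, hxb⟩
      exact ⟨hx, h₂.monotone hxa, h₂.monotone hxb⟩
    · intro a b hab hdis
      rw [disjoint_union_right] at hdis
      obtain ⟨γ₂, hγ₂, he₂⟩ := hB₂ a b hab hdis.1
      obtain ⟨γ₁, hγ₁, he₁⟩ := hB₁ (h₂ a) (h₂ b) (h₂.strictMono hab) (by
        rw [Set.disjoint_left]
        rintro y ⟨h1, h2⟩ hy
        refine hdis.2.notMem_of_mem_left (a := h₂.symm y) ⟨?_, ?_⟩ ?_
        · exact h₂.lt_symm_apply.2 h1
        · exact h₂.symm_apply_lt.2 h2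
        · simpa using hy)
      refine ⟨γ₁ * γ₂, dyadicAffineGroup.mul_mem hγ₁ hγ₂, fun x hx => ?_⟩
      rw [RelIso.mul_apply, RelIso.mul_apply, ← he₂ hx]
      exact he₁ ⟨h₂.monotone hx.1, h₂.monotone hx.2⟩
  inv_mem' := by
    intro h hh
    have hdy := IsPiecewiseDyadic.isDyadic_iff hh
    obtain ⟨B, hd, hf, hB⟩ := hh
    have hinv : ∀ x, h⁻¹ x = h.symm x := fun x => rfl
    refine ⟨h '' B, ?_, ?_, ?_⟩
    · rintro _ ⟨b, hb, rfl⟩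
      exact (hdy b).2 (hd b hb)
    · intro a b
      refine ((hf (h.symm a) (h.symm b)).image h).subset ?_
      rintro _ ⟨⟨x, hx, rfl⟩, hxa, hxb⟩
      exact ⟨x, ⟨hx, h.symm_apply_le.2 hxa, h.le_symm_apply.2 hxb⟩, rfl⟩
    · intro a b hab hdis
      obtain ⟨γ, hγ, he⟩ := hB (h.symm a) (h.symm b) (h.symm.strictMono hab) (by
        rw [Set.disjoint_left]
        rintro x ⟨h1, h2⟩ hx
        exact hdis.notMem_of_mem_left (a := h x)
          ⟨h.symm_apply_lt.1 h1, h.lt_symm_apply.1 h2⟩ ⟨x, hx, rfl⟩)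
      refine ⟨γ⁻¹, dyadicAffineGroup.inv_mem hγ, fun y hy => ?_⟩
      apply γ.injective
      rw [RelIso.apply_inv_self, hinv,
        ← he ⟨h.symm.monotone hy.1, h.symm.monotone hy.2⟩, h.apply_symm_apply]

/-- `f⁻q T_p f^q`, the element substituted for the translation by `p / 2 ^ q`. -/
def reembedTranslation (f : HomeoPlus) (p q : ℤ) : HomeoPlus :=
  f ^ (-q) * translation p * f ^ q

/-- `(f⁻q T_p f^q) f^n`, the image under `θ_f : GA(ℚ₂) → Homeo₊(ℝ)` of the element
`x ↦ 2 ^ n * x + p / 2 ^ q = (D⁻q T_p D^q) D^n`, where `D x = 2 * x`. -/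
def reembedAffine (f : HomeoPlus) (n p q : ℤ) : HomeoPlus :=
  reembedTranslation f p q * f ^ n

/-- The point `r̄ = f⁻q T_p f^q (0)` attached to the dyadic rational `r = p / 2 ^ q`. -/
def barPoint (f : HomeoPlus) (p q : ℤ) : ℝ := reembedTranslation f p q 0

/-- `(t, y)` lies on one of the pieces that make up `θ_f(h)`: there are dyadic rationals
`a = i / 2 ^ j` and `b = k / 2 ^ l` such that `h` agrees on `[a, b]` with an element `γ` of
`GA(ℚ₂)`, `t ∈ [ā, b̄)` and `y = θ_f(γ)(t)`. -/
def OnReembeddedPiece (f h : HomeoPlus) (t y : ℝ) : Prop :=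
  ∃ i j k l n p q : ℤ,
    (∀ x ∈ Icc ((i : ℝ) / (2 : ℝ) ^ j) ((k : ℝ) / (2 : ℝ) ^ l),
      h x = (2 : ℝ) ^ n * x + (p : ℝ) / (2 : ℝ) ^ q) ∧
    t ∈ Ico (barPoint f i j) (barPoint f k l) ∧ y = reembedAffine f n p q t

/-- `θ` is the map `θ_f` on `PL₂(ℝ)`: the graph of `θ h` is exactly the union of the re-embedded
pieces of `h`. At most one `θ` has this property. -/
def IsReembedding (f : HomeoPlus) (θ : PL2 →* HomeoPlus) : Prop :=
  ∀ (h : PL2) (t y : ℝ), θ h t = y ↔ OnReembeddedPiece f h t y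

/-- The increasing self-homeomorphisms of `[0,1]`, a group under composition. -/
abbrev HomeoUnit : Type := Icc (0 : ℝ) 1 ≃o Icc (0 : ℝ) 1

/-- Piecewise linear with finitely many pieces, slopes powers of `2`, and dyadic break points. -/
def IsThompson (h : HomeoUnit) : Prop :=
  ∃ B : Set ℝ, B.Finite ∧ (∀ b ∈ B, IsDyadic b) ∧
    ∀ a b : Icc (0 : ℝ) 1, a < b → Disjoint (Ioo (a : ℝ) b) B →
      ∃ (n : ℤ) (c : ℝ), ∀ t ∈ Icc a b, (h t : ℝ) = (2 : ℝ) ^ n * t + c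

theorem HomeoUnit.map_zero (h : HomeoUnit) : (h ⟨0, by simp⟩ : ℝ) = 0 := by
  apply le_antisymm
  · have : h ⟨0, by simp⟩ ≤ ⟨0, by simp⟩ := by
      rw [← h.le_symm_apply]
      exact (h.symm ⟨0, by simp⟩).2.1
    exact this
  · exact (h _).2.1

theorem IsThompson.isDyadic_iff {h : HomeoUnit} (hh : IsThompson h) (t : Icc (0 : ℝ) 1) :
    IsDyadic (h t) ↔ IsDyadic t := by
  obtain ⟨B, hfin, hd, hB⟩ := hh
  have key : ∀ (N : ℕ) (t : Icc (0 : ℝ) 1), (B ∩ Ioo 0 (t : ℝ)).ncard = N →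
      (IsDyadic (h t) ↔ IsDyadic t) := by
    intro N
    induction N using Nat.strong_induction_on with
    | _ N ih =>
      intro t hN
      have hf : (B ∩ Ioo 0 (t : ℝ)).Finite := hfin.subset inter_subset_left
      have step : ∀ s : Icc (0 : ℝ) 1, s < t → Disjoint (Ioo (s : ℝ) t) B →
          (IsDyadic (h s) ↔ IsDyadic s) → IsDyadic s → (IsDyadic (h t) ↔ IsDyadic t) := by
        intro s hst hdis hs hsd
        obtain ⟨n, c, hc⟩ := hB s t hst hdis
        have h1 := hc t ⟨hst.le, le_rfl⟩
        have h2 := hc s ⟨le_rfl, hst.le⟩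
        have hcd : IsDyadic c := by
          have := (hs.2 hsd).sub (hsd.zpow_mul n)
          rw [h2] at this
          simpa using this
        rw [h1]
        refine ⟨fun h3 => ?_, fun h3 => (h3.zpow_mul n).add hcd⟩
        have := h3.sub hcd
        rwa [add_sub_cancel_right, isDyadic_zpow_mul_iff] at this
      by_cases ht0 : (t : ℝ) = 0
      · have : t = ⟨0, by simp⟩ := Subtype.ext ht0
        rw [this, HomeoUnit.map_zero]
      have htpos : 0 < (t : ℝ) := lt_of_le_of_ne t.2.1 (Ne.symm ht0)
      rcases (B ∩ Ioo 0 (t : ℝ)).eq_empty_or_nonempty with he | hne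
      · refine step ⟨0, by simp⟩ htpos ?_ ?_ IsDyadic.zero
        · rw [Set.disjoint_left]
          intro x hx hxB
          have : x ∈ B ∩ Ioo 0 (t : ℝ) := ⟨hxB, hx⟩
          rw [he] at this
          exact this
        · rw [HomeoUnit.map_zero]
      · obtain ⟨b, ⟨hbB, hb0, hbt⟩, hmax⟩ := hf.exists_maximal hne
        have hb1 : b ≤ 1 := hbt.le.trans t.2.2
        refine step ⟨b, hb0.le, hb1⟩ hbt ?_ ?_ (hd b hbB)
        · rw [Set.disjoint_left]
          rintro x ⟨hx1, hx2⟩ hxB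
          have hx1' : b < x := hx1
          exact absurd (hmax ⟨hxB, hb0.trans hx1', hx2⟩ hx1'.le) (not_le.2 hx1')
        · refine ih _ ?_ ⟨b, hb0.le, hb1⟩ rfl
          rw [← hN]
          refine Set.ncard_lt_ncard ⟨fun x hx => ⟨hx.1, hx.2.1, hx.2.2.trans hbt⟩, fun hsub => ?_⟩ hf
          exact lt_irrefl b (hsub ⟨hbB, hb0, hbt⟩).2.2
  exact key _ t rfl

/-- Thompson's group `F`. -/
def ThompsonF : Subgroup HomeoUnit where
  carrier := {h | IsThompson h}
  one_mem' := ⟨∅, by simp, by simp, fun a b _ _ => ⟨0, 0, fun t _ => by simp⟩⟩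
  mul_mem' := by
    rintro h₁ h₂ ⟨B₁, hf₁, hd₁, hB₁⟩ hh₂
    have hdy := IsThompson.isDyadic_iff hh₂
    obtain ⟨B₂, hf₂, hd₂, hB₂⟩ := hh₂
    refine ⟨B₂ ∪ (↑) '' ((fun t : Icc (0 : ℝ) 1 => (h₂ t : ℝ)) ⁻¹' B₁), ?_, ?_, ?_⟩
    · refine hf₂.union (Set.Finite.image _ (hf₁.preimage ?_))
      exact (Subtype.val_injective.comp h₂.injective).injOn
    · rintro b (hb | ⟨t, ht, rfl⟩)
      · exact hd₂ b hb
      · exact (hdy t).1 (hd₁ _ ht)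
    · intro a b hab hdis
      rw [disjoint_union_right] at hdis
      obtain ⟨n₂, c₂, he₂⟩ := hB₂ a b hab hdis.1
      obtain ⟨n₁, c₁, he₁⟩ := hB₁ (h₂ a) (h₂ b) (h₂.strictMono hab) (by
        rw [Set.disjoint_left]
        rintro y ⟨h1, h2⟩ hy
        have hyI : y ∈ Icc (0 : ℝ) 1 := ⟨(h₂ a).2.1.trans h1.le, h2.le.trans (h₂ b).2.2⟩
        refine hdis.2.notMem_of_mem_left (a := ((h₂.symm ⟨y, hyI⟩ : Icc (0 : ℝ) 1) : ℝ))
          ⟨?_, ?_⟩ ⟨_, ?_, rfl⟩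
        · exact h₂.lt_symm_apply.2 h1
        · exact h₂.symm_apply_lt.2 h2
        · simpa using hy)
      refine ⟨n₁ + n₂, (2 : ℝ) ^ n₁ * c₂ + c₁, fun t ht => ?_⟩
      rw [RelIso.mul_apply, he₁ (h₂ t) ⟨h₂.monotone ht.1, h₂.monotone ht.2⟩, he₂ t ht,
        zpow_add₀ (by norm_num)]
      ring
  inv_mem' := by
    intro h hh
    have hdy := IsThompson.isDyadic_iff hh
    obtain ⟨B, hf, hd, hB⟩ := hh
    have hinv : ∀ x, h⁻¹ x = h.symm x := fun x => rfl
    refine ⟨(fun t : Icc (0 : ℝ) 1 => (h t : ℝ)) '' ((↑) ⁻¹' B), ?_, ?_, ?_⟩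
    · exact (hf.preimage Subtype.val_injective.injOn).image _
    · rintro _ ⟨t, ht, rfl⟩
      exact (hdy t).2 (hd _ ht)
    · intro a b hab hdis
      obtain ⟨n, c, he⟩ := hB (h.symm a) (h.symm b) (h.symm.strictMono hab) (by
        rw [Set.disjoint_left]
        rintro x ⟨h1, h2⟩ hx
        have hxI : x ∈ Icc (0 : ℝ) 1 :=
          ⟨(h.symm a).2.1.trans h1.le, h2.le.trans (h.symm b).2.2⟩
        refine hdis.notMem_of_mem_left (a := (h ⟨x, hxI⟩ : ℝ)) ⟨?_, ?_⟩ ⟨⟨x, hxI⟩, hx, rfl⟩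
        · exact h.symm_apply_lt.1 (show h.symm a < ⟨x, hxI⟩ from h1)
        · exact h.lt_symm_apply.1 (show ⟨x, hxI⟩ < h.symm b from h2))
      refine ⟨-n, -((2 : ℝ) ^ (-n) * c), fun y hy => ?_⟩
      have := he (h.symm y) ⟨h.symm.monotone hy.1, h.symm.monotone hy.2⟩
      rw [h.apply_symm_apply] at this
      rw [hinv, this, zpow_neg]
      have h2 : (2 : ℝ) ^ n ≠ 0 := by positivity
      field_simp
      ring

/-- `H` is `h` on `[0,1]` and the identity outside `[0,1]`. -/
def IsIdentityExtension (h : HomeoUnit) (H : HomeoPlus) : Prop :=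
  (∀ t : Icc (0 : ℝ) 1, H t = h t) ∧ ∀ t : ℝ, t ∉ Icc (0 : ℝ) 1 → H t = t

/-- `g : [0,1] → [0,1]` as a function on `ℝ`, continued by constants. It is only used through its
values on `[0,1]`. -/
noncomputable def HomeoUnit.toFun01 (g : HomeoUnit) : ℝ → ℝ :=
  IccExtend zero_le_one fun t => (g t : ℝ)

theorem HomeoUnit.toFun01_coe (g : HomeoUnit) (t : Icc (0 : ℝ) 1) : g.toFun01 t = g t :=
  IccExtend_val zero_le_one _ t

theorem HomeoUnit.toFun01_mapsTo (g : HomeoUnit) :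
    MapsTo g.toFun01 (Icc (0 : ℝ) 1) (Icc (0 : ℝ) 1) := fun t ht => by
  rw [g.toFun01_coe ⟨t, ht⟩]
  exact (g _).2

theorem HomeoUnit.contDiffOn_mul {r : WithTop ℕ∞} {g h : HomeoUnit}
    (hg : ContDiffOn ℝ r g.toFun01 (Icc (0 : ℝ) 1))
    (hh : ContDiffOn ℝ r h.toFun01 (Icc (0 : ℝ) 1)) :
    ContDiffOn ℝ r (g * h).toFun01 (Icc (0 : ℝ) 1) := by
  refine (hg.comp hh h.toFun01_mapsTo).congr fun t ht => ?_
  rw [Function.comp_apply, h.toFun01_coe ⟨t, ht⟩, g.toFun01_coe,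
    (g * h).toFun01_coe ⟨t, ht⟩, RelIso.mul_apply]

/-- `Diff^r([0,1])`: the increasing self-homeomorphisms of `[0,1]` that are of class `C^r` on
`[0,1]`, together with their inverses. -/
noncomputable def DiffUnit (r : WithTop ℕ∞) : Subgroup HomeoUnit where
  carrier := {g | ContDiffOn ℝ r g.toFun01 (Icc (0 : ℝ) 1) ∧
    ContDiffOn ℝ r (g⁻¹).toFun01 (Icc (0 : ℝ) 1)}
  one_mem' := by
    have h1 : ContDiffOn ℝ r (1 : HomeoUnit).toFun01 (Icc (0 : ℝ) 1) :=
      contDiffOn_id.congr fun t ht => (1 : HomeoUnit).toFun01_coe ⟨t, ht⟩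
    exact ⟨h1, by rwa [inv_one]⟩
  mul_mem' := by
    rintro g h ⟨hg, hg'⟩ ⟨hh, hh'⟩
    refine ⟨HomeoUnit.contDiffOn_mul hg hh, ?_⟩
    rw [mul_inv_rev]
    exact HomeoUnit.contDiffOn_mul hh' hg'
  inv_mem' := by
    rintro g ⟨hg, hg'⟩
    exact ⟨hg', by rwa [inv_inv]⟩

/-- The derivative of `g` at a point of `[0,1]` (one-sided at the end points). -/
noncomputable def HomeoUnit.deriv01 (g : HomeoUnit) (t : ℝ) : ℝ :=
  derivWithin g.toFun01 (Icc (0 : ℝ) 1) t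

/-! The doubling map `D` satisfies `D T_p = T_{2p} D`, and so does any `f` with `f(x+1) = f(x) + 2`.
Substituting `f` for `D` and keeping the integer translations therefore gives a homomorphism `θ_f`
on the affine dyadic group. The point `r̄` is the image of `0` under the substitute for translation
by `r`. For `r = p/2^q` it is `f^{-q}(p)`, so `r ↦ r̄` is strictly increasing, and `θ_f(γ)(s̄)` is
the point attached to `γ(s)`. Hence the re-embedded pieces of a piecewise affine `h` match at their
end points. Every real `t` lies in some `[ā, b̄)` over a piece of `h` (`exists_isAffinePiece_bar`),
the value there does not depend on the piece (`onReembeddedPiece_unique`), and composition can be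
computed piece by piece (`reembedFun_mul`).

Near a break point `ā`, after translating source and target to `0`, the two sides of `θ_f(h)` are
powers `f^m` and `f^n`. Since `f` is tangent to the identity to infinite order at `0`, the map that
is the identity on the left and `f` on the right is a smooth diffeomorphism
(`IsFlatSmooth.rightHalf_mem`), and the two sides join smoothly (`contDiffAt_reembedding`).

The map `r ↦ r̄` jumps at every dyadic: a fixed point `z` of `f` in `(0,1)` lies below `r̄` for all
dyadic `r > 0`. If `h ≠ 1` comes from `F`, the leftmost point `a` where it leaves the identity is
dyadic and `h` has slope `2^n`, `n ≠ 0`, just after it. There `θ_f(h)` is `T f^n T⁻¹` with `T` the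
substitute for translation by `a`. Its fixed point `T z` has derivative `f'(z)^n`, which gives the
bound `|log| ≥ log f'(z)` (`exists_log_deriv_reembedding`).

For the second assertion, the bound is applied to `g h⁻¹` and turned into a bound on a difference by
the chain rule. A suitable `f` with `f'(1/2) ≥ e^C` is built by hand in
`exists_isDegreeTwo_isFlatSmooth`. -/

theorem IsDyadic.exists_common_exponent {r s : ℝ} (hr : IsDyadic r) (hs : IsDyadic s) :
    ∃ p p' q : ℤ, r = (p : ℝ) / (2 : ℝ) ^ q ∧ s = (p' : ℝ) / (2 : ℝ) ^ q := by
  obtain ⟨p, q, rfl⟩ := hr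
  obtain ⟨p', q', rfl⟩ := hs
  have key : ∀ (p q q' : ℤ), q ≤ q' → ∃ p' : ℤ, (p : ℝ) / (2 : ℝ) ^ q = (p' : ℝ) / (2 : ℝ) ^ q' := by
    intro p q q' h
    refine ⟨p * 2 ^ (q' - q).toNat, ?_⟩
    have h2 : (2 : ℝ) ^ q' = 2 ^ (q' - q).toNat * 2 ^ q := by
      rw [← zpow_natCast, Int.toNat_of_nonneg (by omega), ← zpow_add₀ (by norm_num)]
      congr 1
      ring
    have hq0 : (2 : ℝ) ^ q ≠ 0 := by positivity
    push_cast
    rw [h2]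
    field_simp
  rcases le_total q q' with h | h
  · obtain ⟨p₁, h₁⟩ := key p q q' h
    exact ⟨p₁, p', q', h₁, rfl⟩
  · obtain ⟨p₁, h₁⟩ := key p' q' q h
    exact ⟨p, p₁, q, rfl, h₁⟩

theorem IsDyadic.intCast (n : ℤ) : IsDyadic n := ⟨n, 0, by simp⟩

theorem IsDyadic.one : IsDyadic 1 := by simpa using IsDyadic.intCast 1

theorem exists_isDyadic_between {u v : ℝ} (h : u < v) : ∃ c, IsDyadic c ∧ u < c ∧ c < v := by
  obtain ⟨n, hn⟩ := pow_unbounded_of_one_lt (v - u)⁻¹ (one_lt_two (α := ℝ))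
  have hpos : (0 : ℝ) < 2 ^ n := by positivity
  have hn' : 1 < 2 ^ n * (v - u) := by
    rwa [inv_lt_iff_one_lt_mul₀ (sub_pos.2 h)] at hn
  have h1 := Int.lt_floor_add_one (2 ^ n * u)
  have h2 := Int.floor_le (2 ^ n * u)
  refine ⟨((⌊2 ^ n * u⌋ + 1 : ℤ) : ℝ) / 2 ^ (n : ℤ), ⟨_, _, rfl⟩, ?_, ?_⟩
  · rw [zpow_natCast, lt_div_iff₀ hpos]
    push_cast
    linarith
  · rw [zpow_natCast, div_lt_iff₀ hpos]
    push_cast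
    linarith

theorem translation_apply (r x : ℝ) : translation r x = x + r := rfl

theorem translation_add (r s : ℝ) : translation (r + s) = translation r * translation s := by
  ext x
  rw [RelIso.mul_apply, translation_apply, translation_apply, translation_apply]
  ring

/-! ### Degree two maps: the substitutes for dyadic translations and the points `r̄`. -/

/-- `f` fixes `0` and lifts a map of the circle of degree two. -/
structure IsDegreeTwo (f : HomeoPlus) : Prop where
  map_add_one : ∀ x : ℝ, f (x + 1) = f x + 2
  map_zero : f 0 = 0

theorem HomeoPlus.zpow_apply_eq_self {f : HomeoPlus} {x : ℝ} (h : f x = x) (n : ℤ) :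
    (f ^ n) x = x := by
  have h1 : f⁻¹ x = x := by
    conv_lhs => rw [← h]
    exact RelIso.inv_apply_self f x
  induction n using Int.induction_on with
  | zero => rfl
  | succ n ih => rw [zpow_add_one, RelIso.mul_apply, h, ih]
  | pred n ih => rw [zpow_sub_one, RelIso.mul_apply, h1, ih]

namespace IsDegreeTwo

variable {f : HomeoPlus}

theorem zpow_zero (hf : IsDegreeTwo f) (n : ℤ) : (f ^ n) 0 = 0 :=
  HomeoPlus.zpow_apply_eq_self hf.map_zero n

theorem map_add_int (hf : IsDegreeTwo f) (p : ℤ) (x : ℝ) : f (x + p) = f x + 2 * p := by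
  induction p using Int.induction_on with
  | zero => simp
  | succ n ih =>
    have := hf.map_add_one (x + n)
    push_cast at ih ⊢
    rw [← add_assoc, this, ih]
    ring
  | pred n ih =>
    have := hf.map_add_one (x + (-(n : ℝ) - 1))
    push_cast at ih ⊢
    rw [show x + (-(n : ℝ) - 1) + 1 = x + -(n : ℝ) by ring, ih] at this
    linarith

theorem mul_translation (hf : IsDegreeTwo f) (p : ℤ) :
    f * translation p = translation ((2 * p : ℤ) : ℝ) * f := by
  ext x
  rw [RelIso.mul_apply, RelIso.mul_apply, translation_apply, translation_apply, hf.map_add_int]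
  push_cast
  rfl

/-- Conjugation by `f` doubles an integer translation. This makes `reembedTranslation f p q` depend
only on the value of `p / 2 ^ q`. -/
theorem reembedTranslation_two_mul (hf : IsDegreeTwo f) (p q : ℤ) :
    reembedTranslation f (2 * p) (q + 1) = reembedTranslation f p q := by
  unfold reembedTranslation
  have h : translation ((2 * p : ℤ) : ℝ) = f * translation p * f⁻¹ := by
    rw [hf.mul_translation, mul_assoc, mul_inv_cancel, mul_one]
  rw [h, add_comm q 1, zpow_add, neg_add_rev, zpow_add, zpow_neg, zpow_neg, zpow_one]
  group

theorem reembedTranslation_pow_mul (hf : IsDegreeTwo f) (p q : ℤ) (k : ℕ) :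
    reembedTranslation f (p * 2 ^ k) (q + k) = reembedTranslation f p q := by
  induction k with
  | zero => simp
  | succ k ih =>
    rw [← ih, ← hf.reembedTranslation_two_mul (p * 2 ^ k) (q + k)]
    congr 1
    · ring
    · push_cast
      ring

theorem reembedTranslation_congr (hf : IsDegreeTwo f) {p q p' q' : ℤ}
    (h : (p : ℝ) / (2 : ℝ) ^ q = (p' : ℝ) / (2 : ℝ) ^ q') :
    reembedTranslation f p q = reembedTranslation f p' q' := by
  wlog hq : q ≤ q' generalizing p q p' q'
  · exact (this h.symm (le_of_not_ge hq)).symm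
  obtain ⟨k, rfl⟩ := Int.exists_add_of_le hq
  rw [← hf.reembedTranslation_pow_mul p q k]
  congr 1
  have hq0 : (2 : ℝ) ^ q ≠ 0 := by positivity
  rw [zpow_add₀ (by norm_num), zpow_natCast] at h
  field_simp at h
  exact_mod_cast h

end IsDegreeTwo

/-- The image of the translation by the dyadic rational `r` under `θ_f`. -/
noncomputable def reembedT (f : HomeoPlus) (r : ℝ) : HomeoPlus :=
  open Classical in
  if h : IsDyadic r then reembedTranslation f h.choose h.choose_spec.choose else 1

/-- The point `r̄` attached to the dyadic rational `r`. -/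
noncomputable def bar (f : HomeoPlus) (r : ℝ) : ℝ := reembedT f r 0

namespace IsDegreeTwo

variable {f : HomeoPlus}

theorem reembedT_div (hf : IsDegreeTwo f) (p q : ℤ) :
    reembedT f ((p : ℝ) / (2 : ℝ) ^ q) = reembedTranslation f p q := by
  have h : IsDyadic ((p : ℝ) / (2 : ℝ) ^ q) := ⟨p, q, rfl⟩
  rw [reembedT, dif_pos h]
  exact hf.reembedTranslation_congr h.choose_spec.choose_spec.symm

theorem bar_div (hf : IsDegreeTwo f) (p q : ℤ) : bar f ((p : ℝ) / (2 : ℝ) ^ q) = barPoint f p q := by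
  rw [bar, hf.reembedT_div, barPoint]

theorem barPoint_eq (hf : IsDegreeTwo f) (p q : ℤ) : barPoint f p q = (f ^ (-q)) p := by
  rw [barPoint, reembedTranslation, RelIso.mul_apply, RelIso.mul_apply, hf.zpow_zero,
    translation_apply, zero_add]

theorem reembedT_add (hf : IsDegreeTwo f) {r s : ℝ} (hr : IsDyadic r) (hs : IsDyadic s) :
    reembedT f (r + s) = reembedT f r * reembedT f s := by
  obtain ⟨p, p', q, rfl, rfl⟩ := hr.exists_common_exponent hs
  have h : (p : ℝ) / (2 : ℝ) ^ q + (p' : ℝ) / (2 : ℝ) ^ q = ((p + p' : ℤ) : ℝ) / (2 : ℝ) ^ q := by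
    push_cast
    ring
  rw [h, hf.reembedT_div, hf.reembedT_div, hf.reembedT_div, reembedTranslation,
    reembedTranslation, reembedTranslation, Int.cast_add, translation_add, zpow_neg]
  group

/-- The defining relation of the semidirect product of the dyadic rationals by powers of `D`,
transported to `f`; with `reembedT_add` it makes `θ_f` multiplicative. -/
theorem zpow_mul_reembedT (hf : IsDegreeTwo f) (n : ℤ) {r : ℝ} (hr : IsDyadic r) :
    f ^ n * reembedT f r = reembedT f ((2 : ℝ) ^ n * r) * f ^ n := by
  obtain ⟨p, q, rfl⟩ := hr
  have h : (2 : ℝ) ^ n * ((p : ℝ) / (2 : ℝ) ^ q) = (p : ℝ) / (2 : ℝ) ^ (q - n) := by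
    rw [zpow_sub₀ (by norm_num)]
    have h1 : (2 : ℝ) ^ q ≠ 0 := by positivity
    have h2 : (2 : ℝ) ^ n ≠ 0 := by positivity
    field_simp
  rw [h, hf.reembedT_div, hf.reembedT_div, reembedTranslation, reembedTranslation]
  group

theorem reembedT_zero (hf : IsDegreeTwo f) : reembedT f 0 = 1 := by
  have := hf.reembedT_add IsDyadic.zero IsDyadic.zero
  rw [add_zero] at this
  exact left_eq_mul.1 this

/-- `θ_f(γ)(r̄)` is the point attached to `γ(r)`. -/
theorem reembedT_zpow_bar (hf : IsDegreeTwo f) (n : ℤ) {r s : ℝ} (hr : IsDyadic r)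
    (hs : IsDyadic s) : reembedT f r ((f ^ n) (bar f s)) = bar f ((2 : ℝ) ^ n * s + r) := by
  rw [add_comm, bar, bar, hf.reembedT_add hr (hs.zpow_mul n), RelIso.mul_apply]
  congr 1
  rw [← RelIso.mul_apply, hf.zpow_mul_reembedT n hs, RelIso.mul_apply, hf.zpow_zero]

theorem bar_intCast (hf : IsDegreeTwo f) (n : ℤ) : bar f n = n := by
  have := hf.bar_div n 0
  rw [hf.barPoint_eq] at this
  simpa using this

theorem bar_zero (hf : IsDegreeTwo f) : bar f 0 = 0 := by simpa using hf.bar_intCast 0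

theorem bar_one (hf : IsDegreeTwo f) : bar f 1 = 1 := by simpa using hf.bar_intCast 1

/-- Over a common exponent `q` both points are images of integers under the single increasing map `f
^ (-q)`. -/
theorem bar_lt_bar_iff (hf : IsDegreeTwo f) {r s : ℝ} (hr : IsDyadic r) (hs : IsDyadic s) :
    bar f r < bar f s ↔ r < s := by
  obtain ⟨p, p', q, rfl, rfl⟩ := hr.exists_common_exponent hs
  rw [hf.bar_div, hf.bar_div, hf.barPoint_eq, hf.barPoint_eq, OrderIso.lt_iff_lt,
    div_lt_div_iff_of_pos_right (by positivity)]

theorem bar_le_bar_iff (hf : IsDegreeTwo f) {r s : ℝ} (hr : IsDyadic r) (hs : IsDyadic s) :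
    bar f r ≤ bar f s ↔ r ≤ s := by
  rw [← not_lt, ← not_lt, hf.bar_lt_bar_iff hs hr]

/-- A fixed point of `f` in `(0, 1)` lies below `r̄` for every dyadic rational `r > 0`. -/
theorem fixedPoint_lt_bar (hf : IsDegreeTwo f) {z : ℝ} (hz : z < 1) (hfz : f z = z) {r : ℝ}
    (hr : IsDyadic r) (hr0 : 0 < r) : z < bar f r := by
  obtain ⟨p, q, rfl⟩ := hr
  have hp : 0 < p := by
    have := (div_pos_iff_of_pos_right (show (0 : ℝ) < 2 ^ q by positivity)).1 hr0
    exact_mod_cast this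
  rw [hf.bar_div, hf.barPoint_eq]
  calc z = (f ^ (-q)) z := (HomeoPlus.zpow_apply_eq_self hfz _).symm
    _ < (f ^ (-q)) p := by
      rw [OrderIso.lt_iff_lt]
      have : (1 : ℝ) ≤ p := by exact_mod_cast hp
      linarith

end IsDegreeTwo

/-! ### Affine pieces with dyadic end points. -/

theorem PL2.isDyadic_iff (h : PL2) (t : ℝ) : IsDyadic ((h : HomeoPlus) t) ↔ IsDyadic t :=
  IsPiecewiseDyadic.isDyadic_iff h.2 t

theorem exists_gap_left {B : Set ℝ} (hB : ∀ a b : ℝ, (B ∩ Icc a b).Finite) (t : ℝ) :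
    ∃ u, u < t ∧ Disjoint (Ioo u t) B := by
  have hB' : ∀ a b : ℝ, (((fun x : ℝ => -x) ⁻¹' B) ∩ Icc a b).Finite := by
    intro a b
    refine ((hB (-b) (-a)).preimage neg_injective.injOn).subset ?_
    rintro x ⟨hx, hxa, hxb⟩
    exact ⟨hx, neg_le_neg hxb, neg_le_neg hxa⟩
  obtain ⟨u, hu, hd⟩ := exists_gap_right hB' (-t)
  refine ⟨-u, by linarith, Set.disjoint_left.2 fun x hx hxB => ?_⟩
  exact hd.notMem_of_mem_left (a := -x) ⟨by linarith [hx.2], by linarith [hx.1]⟩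
    (by rwa [mem_preimage, neg_neg])

/-- `h` agrees with the element `x ↦ 2 ^ n * x + r` of `GA(ℚ₂)` on `[a, b]`, whose end points are
dyadic. -/
structure IsAffinePiece (h : HomeoPlus) (a b : ℝ) (n : ℤ) (r : ℝ) : Prop where
  left : IsDyadic a
  right : IsDyadic b
  offset : IsDyadic r
  lt : a < b
  eq : ∀ x ∈ Icc a b, h x = (2 : ℝ) ^ n * x + r

theorem IsAffinePiece.mono {h : HomeoPlus} {a b a' b' r : ℝ} {n : ℤ} (H : IsAffinePiece h a b n r)
    (ha : IsDyadic a') (hb : IsDyadic b') (h1 : a ≤ a') (h2 : a' < b') (h3 : b' ≤ b) :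
    IsAffinePiece h a' b' n r :=
  ⟨ha, hb, H.offset, h2, fun x hx => H.eq x ⟨h1.trans hx.1, hx.2.trans h3⟩⟩

theorem IsAffinePiece.unique {h : HomeoPlus} {a b r r' : ℝ} {n n' : ℤ}
    (H : IsAffinePiece h a b n r) (H' : IsAffinePiece h a b n' r') : n = n' ∧ r = r' := by
  have h1 := (H.eq a ⟨le_rfl, H.lt.le⟩).symm.trans (H'.eq a ⟨le_rfl, H.lt.le⟩)
  have h2 := (H.eq b ⟨H.lt.le, le_rfl⟩).symm.trans (H'.eq b ⟨H.lt.le, le_rfl⟩)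
  have h3 : ((2 : ℝ) ^ n - 2 ^ n') * (b - a) = 0 := by linarith
  have h4 : (2 : ℝ) ^ n = 2 ^ n' := by
    rcases mul_eq_zero.1 h3 with h | h
    · linarith
    · linarith [H.lt]
  refine ⟨zpow_right_injective₀ (by norm_num) (by norm_num) h4, ?_⟩
  rw [h4] at h1
  linarith

theorem IsAffinePiece.mul {g h : HomeoPlus} {a b r s : ℝ} {m n : ℤ}
    (Hh : IsAffinePiece h a b n r) (Hg : IsAffinePiece g (h a) (h b) m s) :
    IsAffinePiece (g * h) a b (m + n) ((2 : ℝ) ^ m * r + s) := by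
  refine ⟨Hh.left, Hh.right, (Hh.offset.zpow_mul m).add Hg.offset, Hh.lt, fun x hx => ?_⟩
  rw [RelIso.mul_apply, Hg.eq _ ⟨h.monotone hx.1, h.monotone hx.2⟩, Hh.eq x hx,
    zpow_add₀ (by norm_num)]
  ring

theorem IsPiecewiseDyadic.exists_isAffinePiece {h : HomeoPlus} {B : Set ℝ}
    (hB : ∀ a b : ℝ, a < b → Disjoint (Ioo a b) B → ∃ γ ∈ dyadicAffineGroup, EqOn h γ (Icc a b))
    {a b : ℝ} (ha : IsDyadic a) (hb : IsDyadic b) (hab : a < b) (hd : Disjoint (Ioo a b) B) :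
    ∃ n r, IsAffinePiece h a b n r := by
  obtain ⟨γ, ⟨n, r, hr, hγ⟩, he⟩ := hB a b hab hd
  exact ⟨n, r, ha, hb, hr, hab, fun x hx => (he hx).trans (hγ x)⟩

theorem PL2.exists_isAffinePiece_right (h : PL2) {a : ℝ} (ha : IsDyadic a) :
    ∃ b n r, IsAffinePiece h a b n r := by
  obtain ⟨B, -, hf, hB⟩ := h.2
  obtain ⟨u, hu, hd⟩ := exists_gap_right hf a
  obtain ⟨b, hb, hab, hbu⟩ := exists_isDyadic_between hu
  exact ⟨b, IsPiecewiseDyadic.exists_isAffinePiece hB ha hb hab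
    (hd.mono_left (Ioo_subset_Ioo_right hbu.le))⟩

theorem PL2.exists_isAffinePiece_left (h : PL2) {b : ℝ} (hb : IsDyadic b) :
    ∃ a n r, IsAffinePiece h a b n r := by
  obtain ⟨B, -, hf, hB⟩ := h.2
  obtain ⟨u, hu, hd⟩ := exists_gap_left hf b
  obtain ⟨a, ha, hua, hab⟩ := exists_isDyadic_between hu
  exact ⟨a, IsPiecewiseDyadic.exists_isAffinePiece hB ha hb hab
    (hd.mono_left (Ioo_subset_Ioo_left hua.le))⟩

/-- All break points are dyadic, so a non-dyadic point is interior to a piece. -/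
theorem PL2.exists_isAffinePiece_of_not_isDyadic (h : PL2) {x : ℝ} (hx : ¬ IsDyadic x) :
    ∃ a b n r, IsAffinePiece h a b n r ∧ a < x ∧ x < b := by
  obtain ⟨B, hBd, hf, hB⟩ := h.2
  obtain ⟨u, hu, hdu⟩ := exists_gap_left hf x
  obtain ⟨v, hv, hdv⟩ := exists_gap_right hf x
  obtain ⟨a, ha, hua, hax⟩ := exists_isDyadic_between hu
  obtain ⟨b, hb, hxb, hbv⟩ := exists_isDyadic_between hv
  have hd : Disjoint (Ioo a b) B := by
    rw [Set.disjoint_left]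
    intro y hy hyB
    rcases lt_trichotomy y x with hyx | rfl | hyx
    · exact Set.disjoint_left.1 hdu ⟨hua.trans hy.1, hyx⟩ hyB
    · exact hx (hBd _ hyB)
    · exact Set.disjoint_left.1 hdv ⟨hyx, hy.2.trans hbv⟩ hyB
  obtain ⟨n, r, H⟩ := IsPiecewiseDyadic.exists_isAffinePiece hB ha hb (hax.trans hxb) hd
  exact ⟨a, b, n, r, H, hax, hxb⟩

/-! ### The homomorphism `θ_f` on `PL₂(ℝ)`. -/

namespace IsDegreeTwo

variable {f : HomeoPlus}

/-- The points `r̄` need not be dense, so `t` cannot simply be approximated by them. Instead `t`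
determines a cut of the dyadics, and the supremum of its lower half locates `t`. If the supremum is
dyadic, a piece on its right or on its left is taken according to the side of its bar on which `t`
lies; otherwise a piece around it serves. -/
theorem exists_isAffinePiece_bar (hf : IsDegreeTwo f) (h : PL2) (t : ℝ) :
    ∃ a b n r, IsAffinePiece h a b n r ∧ t ∈ Ico (bar f a) (bar f b) := by
  set S : Set ℝ := {a | IsDyadic a ∧ bar f a ≤ t} with hS
  have hne : S.Nonempty :=
    ⟨⌊t⌋, IsDyadic.intCast _, by rw [hf.bar_intCast]; exact Int.floor_le t⟩
  have hup : ∀ c, IsDyadic c → t < bar f c → c ∈ upperBounds S := fun c hc htc a ha =>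
    ((hf.bar_lt_bar_iff ha.1 hc).1 (ha.2.trans_lt htc)).le
  have hbdd : BddAbove S := ⟨_, hup _ (IsDyadic.intCast (⌊t⌋ + 1)) (by
    rw [hf.bar_intCast]
    push_cast
    exact Int.lt_floor_add_one t)⟩
  have hlo : ∀ c, IsDyadic c → c < sSup S → bar f c ≤ t := by
    intro c hc hcS
    by_contra! hlt
    exact not_le.2 hcS (csSup_le hne (hup c hc hlt))
  have hhi : ∀ c, IsDyadic c → sSup S < c → t < bar f c := by
    intro c hc hcS
    by_contra! hle
    exact not_le.2 hcS (le_csSup hbdd ⟨hc, hle⟩)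
  by_cases hd : IsDyadic (sSup S)
  · by_cases ht : bar f (sSup S) ≤ t
    · obtain ⟨b, n, r, H⟩ := PL2.exists_isAffinePiece_right h hd
      exact ⟨_, b, n, r, H, ht, hhi b H.right H.lt⟩
    · obtain ⟨a, n, r, H⟩ := PL2.exists_isAffinePiece_left h hd
      exact ⟨a, _, n, r, H, hlo a H.left H.lt, not_le.1 ht⟩
  · obtain ⟨a, b, n, r, H, ha, hb⟩ := PL2.exists_isAffinePiece_of_not_isDyadic h hd
    exact ⟨a, b, n, r, H, hlo a H.left ha, hhi b H.right hb⟩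

theorem onReembeddedPiece_iff (hf : IsDegreeTwo f) (h : HomeoPlus) (t y : ℝ) :
    OnReembeddedPiece f h t y ↔ ∃ a b n r, IsAffinePiece h a b n r ∧
      t ∈ Ico (bar f a) (bar f b) ∧ y = reembedT f r ((f ^ n) t) := by
  constructor
  · rintro ⟨i, j, k, l, n, p, q, h1, h2, h3⟩
    rw [← hf.bar_div, ← hf.bar_div] at h2
    refine ⟨_, _, n, (p : ℝ) / (2 : ℝ) ^ q, ⟨⟨i, j, rfl⟩, ⟨k, l, rfl⟩, ⟨p, q, rfl⟩, ?_, h1⟩, h2, ?_⟩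
    · exact (hf.bar_lt_bar_iff ⟨i, j, rfl⟩ ⟨k, l, rfl⟩).1 (h2.1.trans_lt h2.2)
    · rw [h3, hf.reembedT_div, reembedAffine, RelIso.mul_apply]
  · rintro ⟨_, _, n, _, ⟨⟨i, j, rfl⟩, ⟨k, l, rfl⟩, ⟨p, q, rfl⟩, -, h1⟩, h2, h3⟩
    rw [hf.bar_div, hf.bar_div] at h2
    exact ⟨i, j, k, l, n, p, q, h1, h2, by
      rw [h3, hf.reembedT_div, reembedAffine, RelIso.mul_apply]⟩

theorem exists_onReembeddedPiece (hf : IsDegreeTwo f) (h : PL2) (t : ℝ) :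
    ∃ y, OnReembeddedPiece f h t y := by
  obtain ⟨a, b, n, r, H, ht⟩ := hf.exists_isAffinePiece_bar h t
  exact ⟨_, (hf.onReembeddedPiece_iff h t _).2 ⟨a, b, n, r, H, ht, rfl⟩⟩

end IsDegreeTwo

/-- The function underlying `θ_f(h)`. -/
noncomputable def reembedFun (f : HomeoPlus) (h : PL2) (t : ℝ) : ℝ :=
  open Classical in if H : ∃ y, OnReembeddedPiece f h t y then H.choose else 0

namespace IsDegreeTwo

variable {f : HomeoPlus}

/-- Two pieces whose barred intervals share `t` overlap in a nondegenerate dyadic interval, because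
`bar f` preserves order. On that overlap `h` determines both slope and offset. -/
theorem onReembeddedPiece_unique (hf : IsDegreeTwo f) {h : HomeoPlus} {t y y' : ℝ}
    (H : OnReembeddedPiece f h t y) (H' : OnReembeddedPiece f h t y') : y = y' := by
  obtain ⟨a, b, n, r, hp, ht, rfl⟩ := (hf.onReembeddedPiece_iff _ _ _).1 H
  obtain ⟨a', b', n', r', hp', ht', rfl⟩ := (hf.onReembeddedPiece_iff _ _ _).1 H'
  have h1 := (hf.bar_lt_bar_iff hp.left hp'.right).1 (ht.1.trans_lt ht'.2)
  have h2 := (hf.bar_lt_bar_iff hp'.left hp.right).1 (ht'.1.trans_lt ht.2)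
  have hd : IsDyadic (max a a') := by
    rcases max_choice a a' with h | h <;> rw [h]
    exacts [hp.left, hp'.left]
  have hd' : IsDyadic (min b b') := by
    rcases min_choice b b' with h | h <;> rw [h]
    exacts [hp.right, hp'.right]
  have hlt : max a a' < min b b' := max_lt (lt_min hp.lt h1) (lt_min h2 hp'.lt)
  obtain ⟨rfl, rfl⟩ := (hp.mono hd hd' (le_max_left _ _) hlt (min_le_left _ _)).unique
    (hp'.mono hd hd' (le_max_right _ _) hlt (min_le_right _ _))
  rfl

theorem reembedFun_eq_iff (hf : IsDegreeTwo f) (h : PL2) (t y : ℝ) :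
    reembedFun f h t = y ↔ OnReembeddedPiece f h t y := by
  have H := hf.exists_onReembeddedPiece h t
  have h1 : OnReembeddedPiece f h t (reembedFun f h t) := by
    rw [reembedFun, dif_pos H]
    exact H.choose_spec
  exact ⟨fun h2 => h2 ▸ h1, hf.onReembeddedPiece_unique h1⟩

theorem reembedFun_eq (hf : IsDegreeTwo f) {h : PL2} {t a b r : ℝ} {n : ℤ}
    (H : IsAffinePiece h a b n r) (ht : t ∈ Ico (bar f a) (bar f b)) :
    reembedFun f h t = reembedT f r ((f ^ n) t) :=
  (hf.reembedFun_eq_iff h t _).2 ((hf.onReembeddedPiece_iff _ _ _).2 ⟨a, b, n, r, H, ht, rfl⟩)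

theorem affinePiece_bar (hf : IsDegreeTwo f) {h : HomeoPlus} {c a b r : ℝ} {n : ℤ}
    (H : IsAffinePiece h a b n r) (hc : IsDyadic c) (hcab : c ∈ Icc a b) :
    reembedT f r ((f ^ n) (bar f c)) = bar f (h c) := by
  rw [hf.reembedT_zpow_bar n H.offset hc, ← H.eq c hcab]

theorem reembedFun_bar (hf : IsDegreeTwo f) (h : PL2) {c : ℝ} (hc : IsDyadic c) :
    reembedFun f h (bar f c) = bar f ((h : HomeoPlus) c) := by
  obtain ⟨b, n, r, H⟩ := PL2.exists_isAffinePiece_right h hc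
  rw [hf.reembedFun_eq H ⟨le_rfl, (hf.bar_lt_bar_iff H.left H.right).2 H.lt⟩,
    hf.affinePiece_bar H hc ⟨le_rfl, H.lt.le⟩]

/-- Together with `reembedFun_lt_bar`, this compares values across different pieces by means of the
dyadic points between them. It gives monotonicity, and it locates preimages in `reembedFun_mul`. -/
theorem bar_le_reembedFun (hf : IsDegreeTwo f) (h : PL2) {c t : ℝ} (hc : IsDyadic c)
    (hct : bar f c ≤ t) : bar f ((h : HomeoPlus) c) ≤ reembedFun f h t := by
  obtain ⟨a, b, n, r, H, ht⟩ := hf.exists_isAffinePiece_bar h t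
  rw [hf.reembedFun_eq H ht]
  rcases le_total c a with hca | hac
  · calc bar f ((h : HomeoPlus) c) ≤ bar f ((h : HomeoPlus) a) :=
          (hf.bar_le_bar_iff ((PL2.isDyadic_iff h c).2 hc) ((PL2.isDyadic_iff h a).2 H.left)).2
            ((h : HomeoPlus).monotone hca)
      _ = reembedT f r ((f ^ n) (bar f a)) := (hf.affinePiece_bar H H.left ⟨le_rfl, H.lt.le⟩).symm
      _ ≤ _ := (reembedT f r).monotone ((f ^ n).monotone ht.1)
  · have hcb := (hf.bar_lt_bar_iff hc H.right).1 (hct.trans_lt ht.2)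
    rw [← hf.affinePiece_bar H hc ⟨hac, hcb.le⟩]
    exact (reembedT f r).monotone ((f ^ n).monotone hct)

theorem reembedFun_lt_bar (hf : IsDegreeTwo f) (h : PL2) {c t : ℝ} (hc : IsDyadic c)
    (hct : t < bar f c) : reembedFun f h t < bar f ((h : HomeoPlus) c) := by
  obtain ⟨a, b, n, r, H, ht⟩ := hf.exists_isAffinePiece_bar h t
  rw [hf.reembedFun_eq H ht]
  rcases le_total b c with hbc | hcb
  · calc reembedT f r ((f ^ n) t) < reembedT f r ((f ^ n) (bar f b)) :=
          (reembedT f r).strictMono ((f ^ n).strictMono ht.2)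
      _ = bar f ((h : HomeoPlus) b) := hf.affinePiece_bar H H.right ⟨H.lt.le, le_rfl⟩
      _ ≤ _ := (hf.bar_le_bar_iff ((PL2.isDyadic_iff h b).2 H.right) ((PL2.isDyadic_iff h c).2 hc)).2
            ((h : HomeoPlus).monotone hbc)
  · have hac := (hf.bar_lt_bar_iff H.left hc).1 (ht.1.trans_lt hct)
    rw [← hf.affinePiece_bar H hc ⟨hac.le, hcb⟩]
    exact (reembedT f r).strictMono ((f ^ n).strictMono hct)

theorem reembedFun_monotone (hf : IsDegreeTwo f) (h : PL2) : Monotone (reembedFun f h) := by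
  intro t t' htt
  obtain ⟨a, b, n, r, H, ht⟩ := hf.exists_isAffinePiece_bar h t
  rcases lt_or_ge t' (bar f b) with hb | hb
  · rw [hf.reembedFun_eq H ht, hf.reembedFun_eq H ⟨ht.1.trans htt, hb⟩]
    exact (reembedT f r).monotone ((f ^ n).monotone htt)
  · exact (hf.reembedFun_lt_bar h H.right ht.2).le.trans (hf.bar_le_reembedFun h H.right hb)

/-- Once a common piece is found, the identity is the multiplication rule for affine maps, with
`zpow_mul_reembedT` moving `f ^ m` past a translation. -/
theorem reembedFun_mul (hf : IsDegreeTwo f) (g h : PL2) (t : ℝ) :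
    reembedFun f (g * h) t = reembedFun f g (reembedFun f h t) := by
  obtain ⟨a, b, n, r, H, ht⟩ := hf.exists_isAffinePiece_bar h t
  obtain ⟨a', b', m, s, H', ht'⟩ := hf.exists_isAffinePiece_bar g (reembedFun f h t)
  -- the point `t` has a smaller piece on whose image `g` is affine
  have hsymm : ∀ c, IsDyadic c → IsDyadic ((h : HomeoPlus).symm c) := fun c hc =>
    (PL2.isDyadic_iff h _).1 (by rwa [OrderIso.apply_symm_apply])
  set u := max a ((h : HomeoPlus).symm a') with hu
  set v := min b ((h : HomeoPlus).symm b') with hv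
  have hua : bar f u ≤ t := by
    rcases max_choice a ((h : HomeoPlus).symm a') with e | e
    · rw [hu, e]; exact ht.1
    · rw [hu, e]
      by_contra! hlt
      have := hf.reembedFun_lt_bar h (hsymm _ H'.left) hlt
      rw [OrderIso.apply_symm_apply] at this
      exact absurd ht'.1 (not_le.2 this)
  have htv : t < bar f v := by
    rcases min_choice b ((h : HomeoPlus).symm b') with e | e
    · rw [hv, e]; exact ht.2
    · rw [hv, e]
      by_contra! hle
      have := hf.bar_le_reembedFun h (hsymm _ H'.right) hle
      rw [OrderIso.apply_symm_apply] at this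
      exact absurd ht'.2 (not_lt.2 this)
  have hud : IsDyadic u := by
    rcases max_choice a ((h : HomeoPlus).symm a') with e | e <;> rw [hu, e]
    exacts [H.left, hsymm _ H'.left]
  have hvd : IsDyadic v := by
    rcases min_choice b ((h : HomeoPlus).symm b') with e | e <;> rw [hv, e]
    exacts [H.right, hsymm _ H'.right]
  have huv : u < v := (hf.bar_lt_bar_iff hud hvd).1 (hua.trans_lt htv)
  have H1 := H.mono hud hvd (le_max_left _ _) huv (min_le_left _ _)
  have H2 := H'.mono ((PL2.isDyadic_iff h u).2 hud) ((PL2.isDyadic_iff h v).2 hvd)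
    ((h : HomeoPlus).symm_apply_le.1 (le_max_right _ _)) ((h : HomeoPlus).strictMono huv)
    ((h : HomeoPlus).le_symm_apply.1 (min_le_right _ _))
  rw [hf.reembedFun_eq (h := g * h) (H1.mul H2) ⟨hua, htv⟩, hf.reembedFun_eq H' ht',
    hf.reembedFun_eq H ht, add_comm ((2 : ℝ) ^ m * r), hf.reembedT_add H'.offset (H.offset.zpow_mul m),
    zpow_add, RelIso.mul_apply, RelIso.mul_apply, ← RelIso.mul_apply (reembedT f _) (f ^ m),
    ← hf.zpow_mul_reembedT m H.offset, RelIso.mul_apply]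

theorem reembedFun_of_affine (hf : IsDegreeTwo f) {γ : PL2} {n : ℤ} {r : ℝ} (hr : IsDyadic r)
    (hγ : ∀ x, (γ : HomeoPlus) x = (2 : ℝ) ^ n * x + r) (t : ℝ) :
    reembedFun f γ t = reembedT f r ((f ^ n) t) := by
  -- Integers are their own bars, so the unit interval containing `t` is an admissible piece.
  refine hf.reembedFun_eq (a := (⌊t⌋ : ℤ)) (b := ((⌊t⌋ + 1 : ℤ) : ℝ))
    ⟨IsDyadic.intCast _, IsDyadic.intCast _, hr, by push_cast; linarith, fun x _ => hγ x⟩ ?_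
  rw [hf.bar_intCast, hf.bar_intCast]
  push_cast
  exact ⟨Int.floor_le t, Int.lt_floor_add_one t⟩

theorem reembedFun_one (hf : IsDegreeTwo f) (t : ℝ) : reembedFun f 1 t = t := by
  rw [hf.reembedFun_of_affine IsDyadic.zero (n := 0) (fun x => by simp), hf.reembedT_zero]
  rfl

/-- The homomorphism `θ_f` on `PL₂(ℝ)`. -/
noncomputable def reembedding (hf : IsDegreeTwo f) : PL2 →* HomeoPlus where
  toFun h :=
    { toFun := reembedFun f h
      invFun := reembedFun f h⁻¹
      left_inv := fun t => by rw [← hf.reembedFun_mul, inv_mul_cancel, hf.reembedFun_one]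
      right_inv := fun t => by rw [← hf.reembedFun_mul, mul_inv_cancel, hf.reembedFun_one]
      -- Order is reflected because the inverse is of the same form and hence monotone. Continuity
      -- needs no separate argument for an order isomorphism.
      map_rel_iff' := by
        intro s t
        refine ⟨fun h1 => ?_, fun h1 => hf.reembedFun_monotone h h1⟩
        have := hf.reembedFun_monotone h⁻¹ h1
        simpa only [Equiv.coe_fn_mk, ← hf.reembedFun_mul, inv_mul_cancel, hf.reembedFun_one]
          using this }
  map_one' := by
    ext t
    exact hf.reembedFun_one t
  map_mul' g h := by
    ext t
    exact hf.reembedFun_mul g h t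

theorem reembedding_apply (hf : IsDegreeTwo f) (h : PL2) (t : ℝ) :
    hf.reembedding h t = reembedFun f h t := rfl

theorem isReembedding (hf : IsDegreeTwo f) : IsReembedding f hf.reembedding :=
  fun h t y => hf.reembedFun_eq_iff h t y

theorem reembedding_bar (hf : IsDegreeTwo f) (h : PL2) {c : ℝ} (hc : IsDyadic c) :
    hf.reembedding h (bar f c) = bar f ((h : HomeoPlus) c) := hf.reembedFun_bar h hc

theorem reembedding_of_affine (hf : IsDegreeTwo f) (γ : PL2) (n p q : ℤ)
    (hγ : ∀ x, (γ : HomeoPlus) x = (2 : ℝ) ^ n * x + (p : ℝ) / (2 : ℝ) ^ q) :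
    hf.reembedding γ = reembedAffine f n p q := by
  ext t
  rw [hf.reembedding_apply, hf.reembedFun_of_affine ⟨p, q, rfl⟩ hγ, hf.reembedT_div, reembedAffine,
    RelIso.mul_apply]

/-- If `θ_f(h)` is the identity, `h` fixes every dyadic, since `bar f` is injective on dyadics;
density and monotonicity do the rest. -/
theorem reembedding_injective (hf : IsDegreeTwo f) : Function.Injective hf.reembedding := by
  rw [injective_iff_map_eq_one]
  intro h hh
  have key : ∀ c, IsDyadic c → (h : HomeoPlus) c = c := by
    intro c hc
    have h1 := hf.reembedding_bar h hc
    rw [hh] at h1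
    have hd := (PL2.isDyadic_iff h c).2 hc
    exact le_antisymm ((hf.bar_le_bar_iff hd hc).1 h1.symm.le)
      ((hf.bar_le_bar_iff hc hd).1 h1.le)
  ext x
  change (h : HomeoPlus) x = x
  apply le_antisymm
  · by_contra! hlt
    obtain ⟨c, hc, h1, h2⟩ := exists_isDyadic_between hlt
    exact absurd ((h : HomeoPlus).strictMono h1) (by rw [key c hc]; exact h2.le.not_gt)
  · by_contra! hlt
    obtain ⟨c, hc, h1, h2⟩ := exists_isDyadic_between hlt
    exact absurd ((h : HomeoPlus).strictMono h2) (by rw [key c hc]; exact h1.le.not_gt)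

end IsDegreeTwo

/-! ### Smooth gluing at a point of infinite tangency. -/

/-- A smooth function all of whose derivatives vanish at `0` may be cut off to the left of `0`. -/
theorem contDiff_indicator_Ici_of_iteratedDeriv_eq_zero {u : ℝ → ℝ} (hu : ContDiff ℝ ∞ u)
    (h0 : ∀ k : ℕ, iteratedDeriv k u 0 = 0) : ContDiff ℝ ∞ ((Ici (0 : ℝ)).indicator u) := by
  have hderiv : ∀ u : ℝ → ℝ, ContDiff ℝ ∞ u → u 0 = 0 → deriv u 0 = 0 →
      ∀ x, HasDerivAt ((Ici (0 : ℝ)).indicator u) ((Ici (0 : ℝ)).indicator (deriv u) x) x := by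
    intro u hu h0 h1 x
    have hd : HasDerivAt u (deriv u x) x := (hu.differentiable (by simp) x).hasDerivAt
    rcases lt_trichotomy x 0 with hx | rfl | hx
    · rw [indicator_of_notMem (by simpa using hx)]
      refine (hasDerivAt_const x (0 : ℝ)).congr_of_eventuallyEq ?_
      filter_upwards [Iio_mem_nhds hx] with y hy
      exact indicator_of_notMem (by simpa using hy) _
    · rw [indicator_of_mem (by simp), h1]
      rw [h1] at hd
      rw [hasDerivAt_iff_isLittleO] at hd ⊢
      -- The cut-off function is bounded by `|u|`, so it inherits the vanishing derivative at `0`.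
      refine Asymptotics.IsBigO.trans_isLittleO (Asymptotics.IsBigO.of_bound 1 ?_) hd
      filter_upwards with y
      by_cases hy : 0 ≤ y
      · simp [indicator_of_mem (show y ∈ Ici (0 : ℝ) from hy)]
      · simp [indicator_of_notMem (show y ∉ Ici (0 : ℝ) from hy), h0]
    · rw [indicator_of_mem (show x ∈ Ici (0 : ℝ) from hx.le)]
      refine hd.congr_of_eventuallyEq ?_
      filter_upwards [Ioi_mem_nhds hx] with y hy
      exact indicator_of_mem (show y ∈ Ici (0 : ℝ) from Ioi_subset_Ici_self hy) _
  rw [contDiff_infty]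
  intro n
  induction n generalizing u with
  | zero =>
    have h1 : deriv u 0 = 0 := by simpa using h0 1
    have h2 : u 0 = 0 := by simpa using h0 0
    rw [Nat.cast_zero, contDiff_zero, continuous_iff_continuousAt]
    exact fun x => (hderiv u hu h2 h1 x).continuousAt
  | succ n ih =>
    have h1 : deriv u 0 = 0 := by simpa using h0 1
    have h2 : u 0 = 0 := by simpa using h0 0
    rw [Nat.cast_succ, contDiff_succ_iff_deriv]
    refine ⟨fun x => (hderiv u hu h2 h1 x).differentiableAt, fun h => by simp at h, ?_⟩
    rw [show deriv ((Ici (0 : ℝ)).indicator u) = (Ici (0 : ℝ)).indicator (deriv u) from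
      funext fun x => (hderiv u hu h2 h1 x).deriv]
    refine ih (contDiff_infty_iff_deriv.1 hu).2 fun k => ?_
    rw [← iteratedDeriv_succ']
    exact h0 (k + 1)

/-- The increasing `C^∞` diffeomorphisms of `ℝ`. -/
def SmoothHomeo : Subgroup HomeoPlus where
  carrier := {g | ContDiff ℝ ∞ g ∧ ContDiff ℝ ∞ g.symm}
  one_mem' := ⟨contDiff_id, contDiff_id⟩
  mul_mem' := fun ha hb => ⟨ha.1.comp hb.1, hb.2.comp ha.2⟩
  inv_mem' := fun ha => ⟨ha.2, ha.1⟩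

theorem translation_mem_smoothHomeo (r : ℝ) : translation r ∈ SmoothHomeo :=
  ⟨contDiff_id.add contDiff_const, (contDiff_id.add contDiff_const : ContDiff ℝ ∞ fun x => x + -r)⟩

theorem SmoothHomeo.differentiableAt {g : HomeoPlus} (hg : g ∈ SmoothHomeo) (x : ℝ) :
    DifferentiableAt ℝ g x := hg.1.differentiable (by simp) x

theorem SmoothHomeo.deriv_mul {g h : HomeoPlus} (hg : g ∈ SmoothHomeo) (hh : h ∈ SmoothHomeo)
    (x : ℝ) : deriv (g * h : HomeoPlus) x = deriv g (h x) * deriv h x :=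
  deriv_comp x (differentiableAt hg (h x)) (differentiableAt hh x)

theorem deriv_homeoPlus_one (x : ℝ) : deriv (1 : HomeoPlus) x = 1 := deriv_id x

theorem SmoothHomeo.deriv_inv_mul_deriv {g : HomeoPlus} (hg : g ∈ SmoothHomeo) (x : ℝ) :
    deriv (g⁻¹ : HomeoPlus) (g x) * deriv g x = 1 := by
  rw [← deriv_mul (inv_mem hg) hg, inv_mul_cancel, deriv_homeoPlus_one]

theorem SmoothHomeo.deriv_pos {g : HomeoPlus} (hg : g ∈ SmoothHomeo) (x : ℝ) : 0 < deriv g x :=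
  lt_of_le_of_ne g.monotone.deriv_nonneg
    (Ne.symm (right_ne_zero_of_mul_eq_one (deriv_inv_mul_deriv hg x)))

theorem mem_smoothHomeo_of_deriv_ne_zero {g : HomeoPlus} (hg : ContDiff ℝ ∞ g)
    (h : ∀ x, deriv g x ≠ 0) : g ∈ SmoothHomeo :=
  ⟨hg, g.toHomeomorph.contDiff_symm_deriv h
    (fun x => (hg.differentiable (by simp) x).hasDerivAt) hg⟩

theorem SmoothHomeo.deriv_zpow_of_fixed {g : HomeoPlus} (hg : g ∈ SmoothHomeo) {z : ℝ}
    (hz : g z = z) (n : ℤ) : deriv (g ^ n : HomeoPlus) z = deriv g z ^ n := by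
  have h0 := (deriv_pos hg z).ne'
  have hinv : deriv (g⁻¹ : HomeoPlus) z = (deriv g z)⁻¹ := by
    have := deriv_inv_mul_deriv hg z
    rw [hz] at this
    exact eq_inv_of_mul_eq_one_left this
  induction n using Int.induction_on with
  | zero => exact deriv_homeoPlus_one z
  | succ n ih => rw [zpow_add_one, deriv_mul (zpow_mem hg _) hg, hz, ih, zpow_add_one₀ h0]
  | pred n ih =>
    have hz' : (g⁻¹ : HomeoPlus) z = z := by simpa using HomeoPlus.zpow_apply_eq_self hz (-1)
    rw [zpow_sub_one, deriv_mul (zpow_mem hg _) (inv_mem hg), hz', ih, hinv, zpow_sub_one₀ h0]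

/-- The homeomorphism that is `f` on `[0, ∞)` and the identity on `(-∞, 0]`. -/
noncomputable def rightHalf (f : HomeoPlus) (h0 : f 0 = 0) : HomeoPlus where
  toFun x := if 0 ≤ x then f x else x
  invFun x := if 0 ≤ x then f.symm x else x
  left_inv x := by
    by_cases hx : 0 ≤ x
    · have : 0 ≤ f x := by rw [← h0]; exact f.monotone hx
      simp [hx, this]
    · simp [hx]
  right_inv x := by
    by_cases hx : 0 ≤ x
    · have : 0 ≤ f.symm x := by rw [f.le_symm_apply, h0]; exact hx
      simp [hx, this]
    · simp [hx]
  map_rel_iff' := by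
    intro x y
    have key : ∀ x, 0 ≤ f x ↔ 0 ≤ x := fun x => by
      conv_lhs => rw [← h0]
      exact f.le_iff_le
    have k1 := key x
    have k2 := key y
    have k3 := f.le_iff_le (x := x) (y := y)
    simp only [Equiv.coe_fn_mk]
    split_ifs with hx hy hy
    · exact k3
    · exact iff_of_false (fun h => hy ((k1.2 hx).trans h)) (fun h => hy (hx.trans h))
    · have hx' := not_le.1 hx
      exact iff_of_true (hx'.le.trans (k2.2 hy)) (hx'.le.trans hy)
    · rfl

theorem rightHalf_of_nonneg {f : HomeoPlus} (h0 : f 0 = 0) {x : ℝ} (hx : 0 ≤ x) :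
    rightHalf f h0 x = f x := if_pos hx

theorem rightHalf_of_nonpos {f : HomeoPlus} (h0 : f 0 = 0) {x : ℝ} (hx : x ≤ 0) :
    rightHalf f h0 x = x := by
  rcases hx.lt_or_eq with hx | rfl
  · exact if_neg (not_le.2 hx)
  · rw [rightHalf_of_nonneg h0 le_rfl, h0]

theorem zpow_rightHalf_of_nonpos {f : HomeoPlus} (h0 : f 0 = 0) (n : ℤ) {x : ℝ} (hx : x ≤ 0) :
    (rightHalf f h0 ^ n) x = x :=
  HomeoPlus.zpow_apply_eq_self (rightHalf_of_nonpos h0 hx) n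

theorem zpow_rightHalf_of_nonneg {f : HomeoPlus} (h0 : f 0 = 0) (n : ℤ) {x : ℝ} (hx : 0 ≤ x) :
    (rightHalf f h0 ^ n) x = (f ^ n) x := by
  have hpos : ∀ n : ℤ, 0 ≤ (f ^ n) x := fun n => by
    rw [← HomeoPlus.zpow_apply_eq_self h0 n]
    exact (f ^ n).monotone hx
  induction n using Int.induction_on with
  | zero => rfl
  | succ n ih =>
    rw [add_comm, zpow_add, zpow_add, RelIso.mul_apply, RelIso.mul_apply, ih, zpow_one, zpow_one,
      rightHalf_of_nonneg h0 (hpos _)]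
  | pred n ih =>
    apply (rightHalf f h0).injective
    rw [← RelIso.mul_apply, ← zpow_one_add, show 1 + (-(n : ℤ) - 1) = -n by ring, ih,
      rightHalf_of_nonneg h0 (hpos _), ← RelIso.mul_apply, ← zpow_one_add]
    congr 2
    ring

/-- `f` is a `C^∞` diffeomorphism infinitely tangent to the identity at `0`. -/
structure IsFlatSmooth (f : HomeoPlus) : Prop where
  mem : f ∈ SmoothHomeo
  map_zero : f 0 = 0
  deriv_zero : deriv f 0 = 1
  iteratedDeriv_zero : ∀ k : ℕ, 2 ≤ k → iteratedDeriv k f 0 = 0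

theorem iteratedDeriv_id_of_two_le {k : ℕ} (hk : 2 ≤ k) (x : ℝ) :
    iteratedDeriv k (id : ℝ → ℝ) x = 0 := by
  obtain ⟨k, rfl⟩ := Nat.exists_eq_add_of_le' hk
  rw [iteratedDeriv_succ', iteratedDeriv_succ', deriv_id', deriv_const', iteratedDeriv_const]
  simp

theorem IsFlatSmooth.rightHalf_mem {f : HomeoPlus} (hf : IsFlatSmooth f) :
    rightHalf f hf.map_zero ∈ SmoothHomeo := by
  have hu : ContDiff ℝ ∞ (⇑f - id) := hf.mem.1.sub contDiff_id
  have hflat : ∀ k : ℕ, iteratedDeriv k (⇑f - id) 0 = 0 := by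
    intro k
    rw [iteratedDeriv_sub (hf.mem.1.contDiffAt.of_le (by exact_mod_cast le_top))
      contDiff_id.contDiffAt]
    match k with
    | 0 => simp [hf.map_zero]
    | 1 => simp [iteratedDeriv_one, hf.deriv_zero]
    | k + 2 => rw [hf.iteratedDeriv_zero _ (by omega), iteratedDeriv_id_of_two_le (by omega), sub_zero]
  have heq : ⇑(rightHalf f hf.map_zero) = fun x => x + (Ici (0 : ℝ)).indicator (⇑f - id) x := by
    funext x
    by_cases hx : 0 ≤ x
    · rw [rightHalf_of_nonneg _ hx, indicator_of_mem (show x ∈ Ici (0 : ℝ) from hx)]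
      simp
    · rw [rightHalf_of_nonpos _ (not_le.1 hx).le, indicator_of_notMem (show x ∉ Ici (0 : ℝ) from hx),
        add_zero]
  have hs : ContDiff ℝ ∞ (rightHalf f hf.map_zero) := by
    rw [heq]
    exact contDiff_id.add (contDiff_indicator_Ici_of_iteratedDeriv_eq_zero hu hflat)
  refine mem_smoothHomeo_of_deriv_ne_zero hs fun x => ?_
  have hdiff := hs.differentiable (by simp) x
  -- For `x ≤ 0`, including `x = 0`, the map is the identity on `Iic x`. The left derivative `1` is
  -- then the derivative, as differentiability is already known.
  have hud : UniqueDiffWithinAt ℝ (Iic x) x := uniqueDiffOn_Iic x x self_mem_Iic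
  rcases le_or_gt x 0 with hx | hx
  · have heq' : EqOn (rightHalf f hf.map_zero) id (Iic x) :=
      fun y hy => rightHalf_of_nonpos _ (le_trans hy hx)
    rw [← hdiff.derivWithin hud, derivWithin_congr heq' (heq' self_mem_Iic),
      differentiableAt_id.derivWithin hud, deriv_id]
    exact one_ne_zero
  · have : rightHalf f hf.map_zero =ᶠ[nhds x] f := by
      filter_upwards [Ioi_mem_nhds hx] with y hy
      exact rightHalf_of_nonneg _ (le_of_lt hy)
    rw [this.deriv_eq]
    exact (SmoothHomeo.deriv_pos hf.mem x).ne'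

/-! ### Smoothness of `θ_f(h)` and a point of large derivative. -/

namespace IsDegreeTwo

variable {f : HomeoPlus}

theorem reembedT_mem_smoothHomeo (hs : f ∈ SmoothHomeo) (r : ℝ) : reembedT f r ∈ SmoothHomeo := by
  unfold reembedT
  split_ifs
  · exact mul_mem (mul_mem (zpow_mem hs _) (translation_mem_smoothHomeo _)) (zpow_mem hs _)
  · exact one_mem _

/-- On a piece `[a, b]`, `θ_f(h)` is `f ^ n` up to the translations attached to `a` and `h a`. -/
theorem reembedT_zpow_eq (hf : IsDegreeTwo f) {h : HomeoPlus} {a b r : ℝ} {n : ℤ}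
    (H : IsAffinePiece h a b n r) {c : ℝ} (hc : IsDyadic c) (hcab : c ∈ Icc a b) :
    reembedT f r * f ^ n = reembedT f (h c) * f ^ n * (reembedT f c)⁻¹ := by
  rw [eq_mul_inv_iff_mul_eq, mul_assoc, hf.zpow_mul_reembedT n hc, ← mul_assoc,
    ← hf.reembedT_add H.offset (hc.zpow_mul n), H.eq c hcab, add_comm r]

/-- Inside a piece the map is a product of smooth diffeomorphisms. Only the left end `ā` of a piece
needs the flatness of `f`. -/
theorem contDiffAt_reembedding (hf : IsDegreeTwo f) (hs : IsFlatSmooth f) (h : PL2) (t : ℝ) :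
    ContDiffAt ℝ ∞ (hf.reembedding h) t := by
  obtain ⟨a, b, n, r, H, ht⟩ := hf.exists_isAffinePiece_bar h t
  rcases ht.1.lt_or_eq with hat | rfl
  · have hm : reembedT f r * f ^ n ∈ SmoothHomeo :=
      mul_mem (reembedT_mem_smoothHomeo hs.mem r) (zpow_mem hs.mem n)
    refine hm.1.contDiffAt.congr_of_eventuallyEq ?_
    filter_upwards [Ioo_mem_nhds hat ht.2] with s hs'
    exact hf.reembedFun_eq H ⟨hs'.1.le, hs'.2⟩
  · obtain ⟨c, m, s, H'⟩ := PL2.exists_isAffinePiece_left h H.left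
    -- A single smooth formula for both sides of `ā`: in the coordinate centred there, the factor
    -- `rightHalf ^ (n - m)` is trivial on the left, leaving `f ^ m`, and corrects it to `f ^ n` on
    -- the right.
    have hm : reembedT f ((h : HomeoPlus) a) * f ^ m * rightHalf f hs.map_zero ^ (n - m) *
        (reembedT f a)⁻¹ ∈ SmoothHomeo :=
      mul_mem (mul_mem (mul_mem (reembedT_mem_smoothHomeo hs.mem _) (zpow_mem hs.mem m))
        (zpow_mem hs.rightHalf_mem _)) (inv_mem (reembedT_mem_smoothHomeo hs.mem _))
    have hinv : (reembedT f a)⁻¹ (bar f a) = 0 := RelIso.inv_apply_self (reembedT f a) 0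
    have hca : bar f c < bar f a := (hf.bar_lt_bar_iff H'.left H'.right).2 H'.lt
    refine hm.1.contDiffAt.congr_of_eventuallyEq ?_
    filter_upwards [Ioo_mem_nhds hca ht.2] with x hx
    rw [hf.reembedding_apply]
    simp only [RelIso.mul_apply]
    rcases lt_or_ge x (bar f a) with hxa | hxa
    · have h0 : (reembedT f a)⁻¹ x ≤ 0 := by
        rw [← hinv]
        exact (reembedT f a)⁻¹.monotone hxa.le
      rw [hf.reembedFun_eq H' ⟨hx.1.le, hxa⟩, zpow_rightHalf_of_nonpos _ _ h0, ← RelIso.mul_apply,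
        hf.reembedT_zpow_eq H' H.left ⟨H'.lt.le, le_rfl⟩]
      rfl
    · have h0 : 0 ≤ (reembedT f a)⁻¹ x := by
        rw [← hinv]
        exact (reembedT f a)⁻¹.monotone hxa
      rw [hf.reembedFun_eq H ⟨hxa, hx.2⟩, zpow_rightHalf_of_nonneg _ _ h0, ← RelIso.mul_apply,
        hf.reembedT_zpow_eq H H.left ⟨le_rfl, H.lt.le⟩, ← RelIso.mul_apply (f ^ m), ← zpow_add,
        add_sub_cancel]
      rfl

theorem reembedding_mem_smoothHomeo (hf : IsDegreeTwo f) (hs : IsFlatSmooth f) (h : PL2) :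
    hf.reembedding h ∈ SmoothHomeo := by
  refine ⟨contDiff_iff_contDiffAt.2 (hf.contDiffAt_reembedding hs h), ?_⟩
  have := contDiff_iff_contDiffAt.2 (hf.contDiffAt_reembedding hs h⁻¹)
  rwa [map_inv] at this

/-- On a nontrivial piece starting at a fixed point of `h`, the fixed point `z` of `f` produces a
large derivative. -/
theorem exists_log_deriv_reembedding (hf : IsDegreeTwo f) (hs : IsFlatSmooth f) {z : ℝ}
    (hz : z ∈ Ioo (0 : ℝ) 1) (hfz : f z = z) (hfz' : 1 < deriv f z) (h : PL2) {a b r : ℝ} {n : ℤ}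
    (H : IsAffinePiece h a b n r) (hfix : (h : HomeoPlus) a = a) (hn : n ≠ 0) :
    ∃ t ∈ Ioo (bar f a) (bar f b),
      Real.log (deriv f z) ≤ |Real.log (deriv (hf.reembedding h) t)| := by
  set T := reembedT f a with hT
  have hTm : T ∈ SmoothHomeo := reembedT_mem_smoothHomeo hs.mem a
  have h1 : bar f a < T z := T.strictMono hz.1
  have h2 : T z < bar f b := by
    have hb : bar f b = T (bar f (b - a)) := by
      have := hf.reembedT_zpow_bar 0 H.left (H.right.sub H.left)
      simpa using this.symm
    rw [hb]
    exact T.strictMono (hf.fixedPoint_lt_bar hz.2 hfz (H.right.sub H.left) (sub_pos.2 H.lt))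
  refine ⟨T z, ⟨h1, h2⟩, ?_⟩
  have heq : hf.reembedding h =ᶠ[nhds (T z)] (T * f ^ n * T⁻¹ : HomeoPlus) := by
    filter_upwards [Ioo_mem_nhds h1 h2] with s hs'
    rw [hf.reembedding_apply, hf.reembedFun_eq H ⟨hs'.1.le, hs'.2⟩, ← RelIso.mul_apply,
      hf.reembedT_zpow_eq H H.left ⟨le_rfl, H.lt.le⟩, hfix]
  have hfn : (f ^ n) z = z := HomeoPlus.zpow_apply_eq_self hfz n
  have hTi : T⁻¹ (T z) = z := RelIso.inv_apply_self T z
  -- The derivative at a fixed point is invariant under conjugation by `T`.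
  have hd : deriv (hf.reembedding h) (T z) = deriv f z ^ n := by
    rw [heq.deriv_eq, SmoothHomeo.deriv_mul (mul_mem hTm (zpow_mem hs.mem n)) (inv_mem hTm), hTi,
      SmoothHomeo.deriv_mul hTm (zpow_mem hs.mem n), hfn,
      SmoothHomeo.deriv_zpow_of_fixed hs.mem hfz, mul_right_comm, mul_comm (deriv T z),
      SmoothHomeo.deriv_inv_mul_deriv hTm, one_mul]
  have hlog : 0 < Real.log (deriv f z) := Real.log_pos hfz'
  have hn1 : (1 : ℝ) ≤ |(n : ℝ)| := by exact_mod_cast Int.one_le_abs hn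
  rw [hd, Real.log_zpow, abs_mul, abs_of_pos hlog]
  exact le_mul_of_one_le_left hlog.le hn1

end IsDegreeTwo

/-! ### Thompson's group inside `PL₂(ℝ)`. -/

theorem HomeoUnit.map_one (h : HomeoUnit) : (h ⟨1, by simp⟩ : ℝ) = 1 := by
  apply le_antisymm
  · exact (h _).2.2
  · have : ⟨1, by simp⟩ ≤ h ⟨1, by simp⟩ := by
      rw [← h.symm_apply_le]
      exact (h.symm ⟨1, by simp⟩).2.2
    exact this

/-- The function that is `h` on `[0,1]` and the identity elsewhere. -/
noncomputable def HomeoUnit.extendFun (h : HomeoUnit) (x : ℝ) : ℝ :=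
  open Classical in if hx : x ∈ Icc (0 : ℝ) 1 then h ⟨x, hx⟩ else x

namespace HomeoUnit

theorem extendFun_of_mem (h : HomeoUnit) {x : ℝ} (hx : x ∈ Icc (0 : ℝ) 1) :
    h.extendFun x = h ⟨x, hx⟩ := dif_pos hx

theorem extendFun_coe (h : HomeoUnit) (t : Icc (0 : ℝ) 1) : h.extendFun t = h t := dif_pos t.2

theorem extendFun_of_notMem (h : HomeoUnit) {x : ℝ} (hx : x ∉ Icc (0 : ℝ) 1) :
    h.extendFun x = x := dif_neg hx

theorem extendFun_monotone (h : HomeoUnit) : Monotone h.extendFun := by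
  intro x y hxy
  by_cases hx : x ∈ Icc (0 : ℝ) 1 <;> by_cases hy : y ∈ Icc (0 : ℝ) 1
  · rw [h.extendFun_of_mem hx, h.extendFun_of_mem hy]
    exact h.monotone (show (⟨x, hx⟩ : Icc (0 : ℝ) 1) ≤ ⟨y, hy⟩ from hxy)
  · rw [h.extendFun_of_mem hx, h.extendFun_of_notMem hy]
    refine (h _).2.2.trans ?_
    by_contra! hlt
    exact hy ⟨hx.1.trans hxy, hlt.le⟩
  · rw [h.extendFun_of_notMem hx, h.extendFun_of_mem hy]
    refine le_trans ?_ (h _).2.1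
    by_contra! hlt
    exact hx ⟨hlt.le, hxy.trans hy.2⟩
  · rwa [h.extendFun_of_notMem hx, h.extendFun_of_notMem hy]

theorem extendFun_mul (g h : HomeoUnit) (x : ℝ) :
    (g * h).extendFun x = g.extendFun (h.extendFun x) := by
  by_cases hx : x ∈ Icc (0 : ℝ) 1
  · rw [extendFun_of_mem _ hx, extendFun_of_mem _ hx, extendFun_coe, RelIso.mul_apply]
  · rw [extendFun_of_notMem _ hx, extendFun_of_notMem _ hx, extendFun_of_notMem _ hx]

theorem extendFun_one (x : ℝ) : (1 : HomeoUnit).extendFun x = x := by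
  by_cases hx : x ∈ Icc (0 : ℝ) 1
  · rw [extendFun_of_mem _ hx]
    rfl
  · rw [extendFun_of_notMem _ hx]

/-- The increasing homeomorphism of `ℝ` that is `h` on `[0,1]` and the identity elsewhere. -/
noncomputable def extend (h : HomeoUnit) : HomeoPlus :=
  Equiv.toOrderIso
    { toFun := h.extendFun
      invFun := (h⁻¹).extendFun
      left_inv := fun x => by rw [← extendFun_mul, inv_mul_cancel, extendFun_one]
      right_inv := fun x => by rw [← extendFun_mul, mul_inv_cancel, extendFun_one] }
    h.extendFun_monotone (h⁻¹).extendFun_monotone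

theorem extend_apply (h : HomeoUnit) (x : ℝ) : h.extend x = h.extendFun x := rfl

theorem isIdentityExtension_extend (h : HomeoUnit) : IsIdentityExtension h h.extend :=
  ⟨h.extendFun_coe, fun _ hx => h.extendFun_of_notMem hx⟩

theorem extend_of_nonpos (h : HomeoUnit) {x : ℝ} (hx : x ≤ 0) : h.extend x = x := by
  rcases hx.lt_or_eq with hx | rfl
  · exact h.extendFun_of_notMem fun h' => not_le.2 hx h'.1
  · rw [extend_apply, h.extendFun_of_mem (by simp), h.map_zero]

theorem extend_of_one_le (h : HomeoUnit) {x : ℝ} (hx : 1 ≤ x) : h.extend x = x := by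
  rcases hx.lt_or_eq with hx | rfl
  · exact h.extendFun_of_notMem fun h' => not_le.2 hx h'.2
  · rw [extend_apply, h.extendFun_of_mem (by simp), h.map_one]

end HomeoUnit

theorem IsThompson.isPiecewiseDyadic_extend {h : HomeoUnit} (hh : IsThompson h) :
    IsPiecewiseDyadic h.extend := by
  have hdy := hh.isDyadic_iff
  obtain ⟨B, hfin, hd, hB⟩ := hh
  refine ⟨B ∪ {0, 1}, ?_, fun a b => (hfin.union (by simp)).subset inter_subset_left, ?_⟩
  · rintro b (hb | rfl | rfl)
    exacts [hd b hb, IsDyadic.zero, IsDyadic.one]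
  intro a b hab hdis
  have hdB := (disjoint_union_right.1 hdis).1
  rcases le_or_gt b 0 with hb0 | hb0
  · exact ⟨1, one_mem _, fun x hx => h.extend_of_nonpos (hx.2.trans hb0)⟩
  rcases le_or_gt 1 a with ha1 | ha1
  · exact ⟨1, one_mem _, fun x hx => h.extend_of_one_le (ha1.trans hx.1)⟩
  have ha0 : 0 ≤ a := by
    by_contra! hlt
    exact hdis.notMem_of_mem_left (a := 0) ⟨hlt, hb0⟩ (by simp)
  have hb1 : b ≤ 1 := by
    by_contra! hlt
    exact hdis.notMem_of_mem_left (a := 1) ⟨ha1, hlt⟩ (by simp)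
  obtain ⟨n, c, hc⟩ := hB ⟨a, ha0, ha1.le⟩ ⟨b, hb0.le, hb1⟩ hab hdB
  -- The offset `c` is not assumed dyadic in `IsThompson`. It is recovered as `h s - 2 ^ n * s` for
  -- a dyadic `s` in the piece.
  obtain ⟨s, hs, has, hsb⟩ := exists_isDyadic_between hab
  have hsI : s ∈ Icc (0 : ℝ) 1 := ⟨ha0.trans has.le, hsb.le.trans hb1⟩
  have hcd : IsDyadic c := by
    have h1 := hc ⟨s, hsI⟩ ⟨has.le, hsb.le⟩
    have h2 := ((hdy ⟨s, hsI⟩).2 hs).sub (hs.zpow_mul n)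
    rw [h1] at h2
    simpa using h2
  have h2 : (0 : ℝ) < 2 ^ n := by positivity
  let γ : HomeoPlus := (OrderIso.mulLeft₀ ((2 : ℝ) ^ n) h2).trans (OrderIso.addRight c)
  refine ⟨γ, ⟨n, c, hcd, fun x => rfl⟩, fun x hx => ?_⟩
  have hxI : x ∈ Icc (0 : ℝ) 1 := ⟨ha0.trans hx.1, hx.2.trans hb1⟩
  rw [HomeoUnit.extend_apply, h.extendFun_of_mem hxI]
  exact hc ⟨x, hxI⟩ ⟨hx.1, hx.2⟩

/-- Thompson's group as a subgroup of `PL₂(ℝ)`. -/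
noncomputable def ThompsonF.toPL2 : ThompsonF →* PL2 where
  toFun h := ⟨(h : HomeoUnit).extend, IsThompson.isPiecewiseDyadic_extend h.2⟩
  map_one' := by
    ext x
    exact HomeoUnit.extendFun_one x
  map_mul' g h := by
    ext x
    exact HomeoUnit.extendFun_mul g h x

theorem ThompsonF.coe_toPL2 (h : ThompsonF) : (toPL2 h : HomeoPlus) = (h : HomeoUnit).extend := rfl

theorem ThompsonF.exists_toPL2_ne {h : ThompsonF} (hh : h ≠ 1) :
    ∃ x ∈ Ioo (0 : ℝ) 1, (toPL2 h : HomeoPlus) x ≠ x := by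
  by_contra! H
  refine hh (Subtype.ext (RelIso.ext fun t => Subtype.ext ?_))
  change ((h : HomeoUnit) t : ℝ) = t
  rw [← (h : HomeoUnit).extendFun_coe, ← HomeoUnit.extend_apply]
  rcases le_or_gt (t : ℝ) 0 with h0 | h0
  · exact HomeoUnit.extend_of_nonpos _ h0
  rcases le_or_gt 1 (t : ℝ) with h1 | h1
  · exact HomeoUnit.extend_of_one_le _ h1
  · exact H t ⟨h0, h1⟩

/-- The leftmost point where an element of `PL₂(ℝ)` departs from the identity. -/
theorem PL2.exists_nontrivial_piece (h : PL2) (h0 : ∀ x ≤ 0, (h : HomeoPlus) x = x) {x₀ : ℝ}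
    (hx₀ : (h : HomeoPlus) x₀ ≠ x₀) :
    ∃ a b n r, IsAffinePiece h a b n r ∧ 0 ≤ a ∧ a ≤ x₀ ∧ (h : HomeoPlus) a = a ∧ n ≠ 0 := by
  set S : Set ℝ := {t | ∀ s ≤ t, (h : HomeoPlus) s = s} with hS
  have h0S : (0 : ℝ) ∈ S := h0
  have hbd : x₀ ∈ upperBounds S := fun t ht => by
    by_contra! hlt
    exact hx₀ (ht x₀ hlt.le)
  have hbdd : BddAbove S := ⟨x₀, hbd⟩
  set a := sSup S with ha
  have hlt : ∀ s < a, (h : HomeoPlus) s = s := by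
    intro s hs
    obtain ⟨t, ht, hst⟩ := exists_lt_of_lt_csSup ⟨0, h0S⟩ hs
    exact ht s hst.le
  have hclosed : IsClosed {s | (h : HomeoPlus) s = s} :=
    isClosed_eq (h : HomeoPlus).continuous continuous_id
  have hfix : (h : HomeoPlus) a = a := by
    have : a ∈ closure (Iio a) := by rw [closure_Iio]; exact self_mem_Iic
    exact hclosed.closure_subset_iff.2 (fun s hs => hlt s hs) this
  have hle : ∀ s ≤ a, (h : HomeoPlus) s = s := fun s hs => by
    rcases hs.lt_or_eq with hs | rfl
    exacts [hlt s hs, hfix]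
  have hmax : ∀ b, a < b → ¬ ∀ s ∈ Icc a b, (h : HomeoPlus) s = s := by
    intro b hab hb
    refine not_le.2 hab (le_csSup hbdd fun s hs => ?_)
    rcases le_total s a with hsa | hsa
    exacts [hle s hsa, hb s ⟨hsa, hs⟩]
  by_cases hd : IsDyadic a
  · obtain ⟨b, n, r, H⟩ := PL2.exists_isAffinePiece_right h hd
    refine ⟨a, b, n, r, H, le_csSup hbdd h0S, csSup_le ⟨0, h0S⟩ hbd, hfix, ?_⟩
    rintro rfl
    refine hmax b H.lt fun s hs => ?_
    have h1 := H.eq a ⟨le_rfl, H.lt.le⟩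
    have h2 := H.eq s hs
    rw [hfix] at h1
    simp only [zpow_zero, one_mul] at h1 h2
    linarith
  -- A non-dyadic `a` would be interior to a piece, on which `h` fixes both `a` and `c < a`. Such a
  -- piece is the identity, and so `h` would stay trivial beyond `a`.
  · exfalso
    obtain ⟨c, d, n, r, H, hca, had⟩ := PL2.exists_isAffinePiece_of_not_isDyadic h hd
    refine hmax d had fun s hs => ?_
    have h1 := H.eq a ⟨hca.le, had.le⟩
    have h2 := H.eq c ⟨le_rfl, H.lt.le⟩
    have h3 := H.eq s ⟨hca.le.trans hs.1, hs.2⟩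
    rw [hfix] at h1
    rw [hlt c hca] at h2
    have h4 : ((2 : ℝ) ^ n - 1) * (a - c) = 0 := by linarith
    have h5 : (2 : ℝ) ^ n = 1 := by
      rcases mul_eq_zero.1 h4 with h | h <;> linarith
    rw [h5] at h1 h3
    linarith

/-! ### Restriction to `[0,1]` and the chain rule for one-sided derivatives. -/

namespace HomeoUnit

/-- The restriction to `[0,1]` of an increasing homeomorphism of `ℝ` fixing `0` and `1`. -/
def restrict (g : HomeoPlus) (h0 : g 0 = 0) (h1 : g 1 = 1) : HomeoUnit where
  toFun t := ⟨g t, h0.symm.le.trans (g.monotone t.2.1), (g.monotone t.2.2).trans h1.le⟩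
  invFun t := ⟨g.symm t, by rw [g.le_symm_apply, h0]; exact t.2.1,
    by rw [g.symm_apply_le, h1]; exact t.2.2⟩
  left_inv t := Subtype.ext (g.symm_apply_apply t)
  right_inv t := Subtype.ext (g.apply_symm_apply t)
  map_rel_iff' := g.le_iff_le

theorem toFun01_restrict (g : HomeoPlus) (h0 : g 0 = 0) (h1 : g 1 = 1) :
    EqOn (restrict g h0 h1).toFun01 g (Icc (0 : ℝ) 1) :=
  fun t ht => (restrict g h0 h1).toFun01_coe ⟨t, ht⟩

theorem restrict_mem_diffUnit {g : HomeoPlus} (hg : g ∈ SmoothHomeo) (h0 : g 0 = 0)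
    (h1 : g 1 = 1) : restrict g h0 h1 ∈ DiffUnit ∞ := by
  refine ⟨hg.1.contDiffOn.congr (toFun01_restrict g h0 h1), hg.2.contDiffOn.congr ?_⟩
  exact fun t ht => ((restrict g h0 h1)⁻¹).toFun01_coe ⟨t, ht⟩

theorem deriv01_restrict {g : HomeoPlus} (hg : g ∈ SmoothHomeo) (h0 : g 0 = 0) (h1 : g 1 = 1)
    {t : ℝ} (ht : t ∈ Icc (0 : ℝ) 1) : (restrict g h0 h1).deriv01 t = deriv g t := by
  rw [deriv01, derivWithin_congr (toFun01_restrict g h0 h1) (toFun01_restrict g h0 h1 ht)]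
  exact (SmoothHomeo.differentiableAt hg t).derivWithin (uniqueDiffOn_Icc zero_lt_one t ht)

theorem differentiableOn_toFun01 {g : HomeoUnit} (hg : g ∈ DiffUnit ∞) :
    DifferentiableOn ℝ g.toFun01 (Icc (0 : ℝ) 1) := hg.1.differentiableOn (by simp)

theorem deriv01_mul {g h : HomeoUnit} (hg : g ∈ DiffUnit ∞) (hh : h ∈ DiffUnit ∞)
    (t : Icc (0 : ℝ) 1) : (g * h).deriv01 t = g.deriv01 (h t) * h.deriv01 t := by
  have heq : EqOn (g * h).toFun01 (g.toFun01 ∘ h.toFun01) (Icc (0 : ℝ) 1) := fun t ht => by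
    rw [Function.comp_apply, h.toFun01_coe ⟨t, ht⟩, g.toFun01_coe, (g * h).toFun01_coe ⟨t, ht⟩,
      RelIso.mul_apply]
  rw [deriv01, derivWithin_congr heq (heq t.2),
    derivWithin_comp (h₂ := g.toFun01) (s' := Icc (0 : ℝ) 1) (t : ℝ)
      (differentiableOn_toFun01 hg _ (h.toFun01_mapsTo t.2))
      (differentiableOn_toFun01 hh t t.2) h.toFun01_mapsTo, h.toFun01_coe]
  rfl

theorem deriv01_one {t : ℝ} (ht : t ∈ Icc (0 : ℝ) 1) : (1 : HomeoUnit).deriv01 t = 1 := by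
  have heq : EqOn (1 : HomeoUnit).toFun01 id (Icc (0 : ℝ) 1) :=
    fun t ht => (1 : HomeoUnit).toFun01_coe ⟨t, ht⟩
  rw [deriv01, derivWithin_congr heq (heq ht)]
  exact derivWithin_id _ _ (uniqueDiffOn_Icc zero_lt_one t ht)

theorem deriv01_ne_zero {g : HomeoUnit} (hg : g ∈ DiffUnit ∞) (t : Icc (0 : ℝ) 1) :
    g.deriv01 t ≠ 0 := by
  have := deriv01_mul (inv_mem hg) hg t
  rw [inv_mul_cancel, deriv01_one t.2] at this
  exact right_ne_zero_of_mul_eq_one this.symm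

end HomeoUnit

/-! ### The homomorphism from `F` to `Diff^∞([0,1])`. -/

namespace IsDegreeTwo

variable {f : HomeoPlus}

theorem reembedding_eq_self_of_piece (hf : IsDegreeTwo f) {h : PL2} {a b : ℝ} (ha : IsDyadic a)
    (hb : IsDyadic b) (hab : a < b) (H : ∀ x ∈ Icc a b, (h : HomeoPlus) x = x) :
    EqOn (hf.reembedding h) id (Icc (bar f a) (bar f b)) := by
  intro t ht
  rcases ht.2.lt_or_eq with htb | rfl
  · rw [hf.reembedding_apply, hf.reembedFun_eq (n := 0)
      ⟨ha, hb, IsDyadic.zero, hab, fun x hx => by simpa using H x hx⟩ ⟨ht.1, htb⟩, hf.reembedT_zero]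
    rfl
  · rw [hf.reembedding_bar h hb, H b ⟨hab.le, le_rfl⟩]
    rfl

/-- End points are included: a one-sided derivative determines the derivative of a map known to be
smooth. This is what fixes the slopes at `0` and `1`, since elements of `F` extend by the identity
to `[-1, 0]` and `[1, 2]`. -/
theorem deriv_reembedding_of_piece (hf : IsDegreeTwo f) (hs : IsFlatSmooth f) {h : PL2} {a b : ℝ}
    (ha : IsDyadic a) (hb : IsDyadic b) (hab : a < b)
    (H : ∀ x ∈ Icc a b, (h : HomeoPlus) x = x) {t : ℝ} (ht : t ∈ Icc (bar f a) (bar f b)) :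
    deriv (hf.reembedding h) t = 1 := by
  have hu := uniqueDiffOn_Icc ((hf.bar_lt_bar_iff ha hb).2 hab) t ht
  have heq := hf.reembedding_eq_self_of_piece ha hb hab H
  rw [← (SmoothHomeo.differentiableAt (hf.reembedding_mem_smoothHomeo hs h) t).derivWithin hu,
    derivWithin_congr heq (heq ht)]
  exact derivWithin_id _ _ hu

theorem reembedding_toPL2_zero (hf : IsDegreeTwo f) (h : ThompsonF) :
    hf.reembedding (ThompsonF.toPL2 h) 0 = 0 := by
  have := hf.reembedding_bar (ThompsonF.toPL2 h) IsDyadic.zero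
  rwa [ThompsonF.coe_toPL2, HomeoUnit.extend_of_nonpos _ le_rfl, hf.bar_zero] at this

theorem reembedding_toPL2_one (hf : IsDegreeTwo f) (h : ThompsonF) :
    hf.reembedding (ThompsonF.toPL2 h) 1 = 1 := by
  have := hf.reembedding_bar (ThompsonF.toPL2 h) IsDyadic.one
  rwa [ThompsonF.coe_toPL2, HomeoUnit.extend_of_one_le _ le_rfl, hf.bar_one] at this

/-- The homomorphism `F → Diff^∞([0,1])` obtained by restricting `θ_f`. -/
noncomputable def thompsonHom (hf : IsDegreeTwo f) (hs : IsFlatSmooth f) :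
    ThompsonF →* DiffUnit ∞ where
  toFun h := ⟨HomeoUnit.restrict _ (hf.reembedding_toPL2_zero h) (hf.reembedding_toPL2_one h),
    HomeoUnit.restrict_mem_diffUnit (hf.reembedding_mem_smoothHomeo hs _) _ _⟩
  map_one' := by
    refine Subtype.ext (RelIso.ext fun t => Subtype.ext ?_)
    change hf.reembedding (ThompsonF.toPL2 1) t = t
    rw [map_one, map_one]
    rfl
  map_mul' g h := by
    refine Subtype.ext (RelIso.ext fun t => Subtype.ext ?_)
    change hf.reembedding (ThompsonF.toPL2 (g * h)) t =
      hf.reembedding (ThompsonF.toPL2 g) (hf.reembedding (ThompsonF.toPL2 h) t)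
    rw [map_mul, map_mul]
    rfl

theorem deriv01_thompsonHom (hf : IsDegreeTwo f) (hs : IsFlatSmooth f) (h : ThompsonF) {t : ℝ}
    (ht : t ∈ Icc (0 : ℝ) 1) :
    HomeoUnit.deriv01 (hf.thompsonHom hs h) t =
      deriv (hf.reembedding (ThompsonF.toPL2 h)) t :=
  HomeoUnit.deriv01_restrict (hf.reembedding_mem_smoothHomeo hs _) (hf.reembedding_toPL2_zero h)
    (hf.reembedding_toPL2_one h) ht

theorem deriv01_thompsonHom_zero (hf : IsDegreeTwo f) (hs : IsFlatSmooth f) (h : ThompsonF) :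
    HomeoUnit.deriv01 (hf.thompsonHom hs h) 0 = 1 := by
  rw [hf.deriv01_thompsonHom hs h (by simp)]
  refine hf.deriv_reembedding_of_piece hs IsDyadic.one.neg IsDyadic.zero (by norm_num)
    (fun x hx => HomeoUnit.extend_of_nonpos _ hx.2) ?_
  rw [← hf.bar_zero, mem_Icc, hf.bar_le_bar_iff IsDyadic.one.neg IsDyadic.zero, hf.bar_zero]
  norm_num [hf.bar_zero]

theorem deriv01_thompsonHom_one (hf : IsDegreeTwo f) (hs : IsFlatSmooth f) (h : ThompsonF) :
    HomeoUnit.deriv01 (hf.thompsonHom hs h) 1 = 1 := by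
  rw [hf.deriv01_thompsonHom hs h (by simp)]
  have h2 : IsDyadic (1 + 1) := IsDyadic.one.add IsDyadic.one
  refine hf.deriv_reembedding_of_piece hs IsDyadic.one h2 (by norm_num)
    (fun x hx => HomeoUnit.extend_of_one_le _ hx.1) ⟨hf.bar_one.le, ?_⟩
  have := (hf.bar_le_bar_iff IsDyadic.one h2).2 (by norm_num)
  rwa [hf.bar_one] at this

theorem exists_log_deriv01_thompsonHom (hf : IsDegreeTwo f) (hs : IsFlatSmooth f) {z : ℝ}
    (hz : z ∈ Ioo (0 : ℝ) 1) (hfz : f z = z) (hfz' : 1 < deriv f z) {h : ThompsonF} (hh : h ≠ 1) :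
    ∃ t ∈ Icc (0 : ℝ) 1,
      Real.log (deriv f z) ≤ |Real.log (HomeoUnit.deriv01 (hf.thompsonHom hs h) t)| := by
  obtain ⟨x₀, hx₀, hne⟩ := ThompsonF.exists_toPL2_ne hh
  obtain ⟨a, b, n, r, H, ha0, hax, hfix, hn⟩ := PL2.exists_nontrivial_piece (ThompsonF.toPL2 h)
    (fun x hx => HomeoUnit.extend_of_nonpos _ hx) hne
  -- The piece may extend past `1`; truncating it keeps the point `t` in `[0,1]`.
  have hd : IsDyadic (min b 1) := by
    rcases min_choice b 1 with e | e <;> rw [e]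
    exacts [H.right, IsDyadic.one]
  obtain ⟨t, ht, hlog⟩ := hf.exists_log_deriv_reembedding hs hz hfz hfz' (ThompsonF.toPL2 h)
    (H.mono H.left hd le_rfl (lt_min H.lt (hax.trans_lt hx₀.2)) (min_le_left _ _)) hfix hn
  have h0 := (hf.bar_le_bar_iff IsDyadic.zero H.left).2 ha0
  have h1 := (hf.bar_le_bar_iff hd IsDyadic.one).2 (min_le_right b 1)
  rw [hf.bar_zero] at h0
  rw [hf.bar_one] at h1
  have htI : t ∈ Icc (0 : ℝ) 1 := ⟨h0.trans ht.1.le, ht.2.le.trans h1⟩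
  refine ⟨t, htI, ?_⟩
  rwa [hf.deriv01_thompsonHom hs h htI]

/-- A nontrivial element has a point with `|log|` of the derivative at least `log f'(z) > 0`, which
the identity has not. -/
theorem thompsonHom_injective (hf : IsDegreeTwo f) (hs : IsFlatSmooth f) {z : ℝ}
    (hz : z ∈ Ioo (0 : ℝ) 1) (hfz : f z = z) (hfz' : 1 < deriv f z) :
    Function.Injective (hf.thompsonHom hs) := by
  rw [injective_iff_map_eq_one]
  intro h hh
  by_contra hne
  obtain ⟨t, ht, hlog⟩ := hf.exists_log_deriv01_thompsonHom hs hz hfz hfz' hne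
  rw [hh, OneMemClass.coe_one, HomeoUnit.deriv01_one ht, Real.log_one, abs_zero] at hlog
  exact absurd (Real.log_pos hfz') (not_lt.2 hlog)

/-- A lower bound for `|log g'|` on the image gives a lower bound for the `C^1` distance. -/
theorem exists_log_deriv01_sub (hf : IsDegreeTwo f) (hs : IsFlatSmooth f) {z : ℝ}
    (hz : z ∈ Ioo (0 : ℝ) 1) (hfz : f z = z) (hfz' : 1 < deriv f z) {g h : ThompsonF}
    (hgh : g ≠ h) :
    ∃ t ∈ Icc (0 : ℝ) 1, Real.log (deriv f z) ≤
      |Real.log (HomeoUnit.deriv01 (hf.thompsonHom hs g) t) -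
        Real.log (HomeoUnit.deriv01 (hf.thompsonHom hs h) t)| := by
  have hne : g * h⁻¹ ≠ 1 := fun h' => hgh (mul_inv_eq_one.1 h')
  obtain ⟨s, hs1, hlog⟩ := hf.exists_log_deriv01_thompsonHom hs hz hfz hfz' hne
  set φ := hf.thompsonHom hs with hφ
  -- By the chain rule, the difference of logarithms for `g` and `h` at `t` is the logarithm for `g
  -- * h⁻¹` at the image of `t` under `φ h`; hence the preimage of `s` is taken.
  let t : Icc (0 : ℝ) 1 := (φ h : HomeoUnit).symm ⟨s, hs1⟩
  have hts : ((φ h : HomeoUnit) t : ℝ) = s := by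
    rw [OrderIso.apply_symm_apply]
  have hmul : (φ g : HomeoUnit) = (φ (g * h⁻¹) : HomeoUnit) * (φ h : HomeoUnit) := by
    rw [← Subgroup.coe_mul, ← map_mul, inv_mul_cancel_right]
  refine ⟨t, t.2, ?_⟩
  rw [hmul, HomeoUnit.deriv01_mul (φ (g * h⁻¹)).2 (φ h).2, Real.log_mul
    (HomeoUnit.deriv01_ne_zero (φ (g * h⁻¹)).2 _) (HomeoUnit.deriv01_ne_zero (φ h).2 _),
    add_sub_cancel_right, hts]
  exact hlog

end IsDegreeTwo

/-! ### Existence of a suitable `f`. -/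

/-- Smooth functions increasing from `0` to `1` except for a dip of small slope, and steep at
`1/2`. -/
theorem exists_smooth_step (M : ℝ) : ∃ w : ℝ → ℝ, ContDiff ℝ ∞ w ∧ (∀ x, x ≤ 1 / 4 → w x = 0) ∧
    (∀ x, 3 / 4 ≤ x → w x = 1) ∧ (∀ x, -1 < deriv w x) ∧ w (1 / 2) = 0 ∧ M ≤ deriv w (1 / 2) := by
  let β : ContDiffBump (1 / 2 : ℝ) := ⟨1 / 8, 1 / 4, by norm_num, by norm_num⟩
  have hβ : ContDiff ℝ ∞ β := β.contDiff
  have hβ' : Continuous (deriv β) := hβ.continuous_deriv (by simp)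
  obtain ⟨K, hK⟩ := β.hasCompactSupport.deriv.exists_bound_of_continuous hβ'
  have hK0 : 0 ≤ K := (norm_nonneg _).trans (hK 0)
  -- The function is `s + c β v`. Only the term `c β' v` can make its derivative negative; with
  -- `|β'| ≤ K` and `|v| ≤ 2`, this `c` keeps that term above `-1`.
  set c : ℝ := 1 / (2 * K + 1) with hc
  have hcpos : 0 < c := by positivity
  have hcK : c * (K * 2) < 1 := by
    rw [hc, one_div, inv_mul_lt_iff₀ (by positivity)]
    linarith
  -- The arctangent stays bounded however large `l` is, so the slope at `1/2`, where `β` is `1`, can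
  -- be made at least `c * l = |M|` without changing `c`.
  set l : ℝ := |M| / c with hl
  have hl0 : 0 ≤ l := by positivity
  let s : ℝ → ℝ := fun x => Real.smoothTransition (4 * x - 2)
  let v : ℝ → ℝ := fun x => Real.arctan (l * (x - 1 / 2))
  have hs : ContDiff ℝ ∞ s :=
    Real.smoothTransition.contDiff.comp ((contDiff_const.mul contDiff_id).sub contDiff_const)
  have hsm : Monotone s := fun x y hxy => Real.smoothTransition.monotone (by linarith)
  have hv : ContDiff ℝ ∞ v :=
    Real.contDiff_arctan.comp (contDiff_const.mul (contDiff_id.sub contDiff_const))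
  have hv' : ∀ x, HasDerivAt v (1 / (1 + (l * (x - 1 / 2)) ^ 2) * l) x := by
    intro x
    have := (((hasDerivAt_id x).sub_const (1 / 2)).const_mul l).arctan
    simpa [v] using this
  have hw : ContDiff ℝ ∞ fun x => s x + c * (β x * v x) :=
    hs.add (contDiff_const.mul (hβ.mul hv))
  have hβ0 : ∀ x, 1 / 4 ≤ |x - 1 / 2| → β x = 0 := fun x hx =>
    β.zero_of_le_dist (by rwa [Real.dist_eq])
  have hderiv : ∀ x, deriv (fun x => s x + c * (β x * v x)) x =
      deriv s x + c * (deriv β x * v x + β x * (1 / (1 + (l * (x - 1 / 2)) ^ 2) * l)) := by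
    intro x
    exact ((hs.differentiable (by simp) x).hasDerivAt.add
      (((hβ.differentiable (by simp) x).hasDerivAt.mul (hv' x)).const_mul c)).deriv
  have hβhalf : β (1 / 2) = 1 := β.one_of_mem_closedBall (by simp [β.rIn_pos.le])
  refine ⟨_, hw, fun x hx => ?_, fun x hx => ?_, fun x => ?_, ?_, ?_⟩
  · have h1 : s x = 0 := Real.smoothTransition.zero_of_nonpos (by linarith)
    have h2 : β x = 0 := hβ0 x (by rw [abs_of_nonpos (by linarith)]; linarith)
    simp only [h1, h2]
    ring
  · have h1 : s x = 1 := Real.smoothTransition.one_of_one_le (by linarith)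
    have h2 : β x = 0 := hβ0 x (by rw [abs_of_nonneg (by linarith)]; linarith)
    simp only [h1, h2]
    ring
  · rw [hderiv]
    have h1 : 0 ≤ deriv s x := hsm.deriv_nonneg
    have h2 : 0 ≤ β x * (1 / (1 + (l * (x - 1 / 2)) ^ 2) * l) :=
      mul_nonneg β.nonneg (by positivity)
    have h3 : |v x| ≤ 2 := by
      rw [abs_le]
      have := Real.neg_pi_div_two_lt_arctan (l * (x - 1 / 2))
      have := Real.arctan_lt_pi_div_two (l * (x - 1 / 2))
      have := Real.pi_lt_four
      constructor <;> simp only [v] <;> linarith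
    have h4 : |deriv β x * v x| ≤ K * 2 := by
      rw [abs_mul]
      exact mul_le_mul (hK x) h3 (abs_nonneg _) hK0
    have h5 := mul_le_mul_of_nonneg_left (abs_le.1 h4).1 hcpos.le
    have h6 := mul_nonneg hcpos.le h2
    rw [mul_add]
    linarith
  · have h1 : s (1 / 2) = 0 := Real.smoothTransition.zero_of_nonpos (by norm_num)
    simp only [h1, v, sub_self, mul_zero, Real.arctan_zero, add_zero]
  · rw [hderiv, hβhalf]
    have h1 : 0 ≤ deriv s (1 / 2) := hsm.deriv_nonneg
    have h2 : c * l = |M| := by rw [hl]; field_simp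
    have h3 := le_abs_self M
    simp only [v, sub_self, mul_zero, Real.arctan_zero]
    norm_num
    linarith

/-- There are degree two diffeomorphisms flat at `0` with a fixed point of large derivative. -/
theorem exists_isDegreeTwo_isFlatSmooth (M : ℝ) : ∃ f : HomeoPlus, IsDegreeTwo f ∧ IsFlatSmooth f ∧
    f (1 / 2) = 1 / 2 ∧ M ≤ deriv f (1 / 2) := by
  obtain ⟨w, hw, hw0, hw1, hw', hwz, hwM⟩ := exists_smooth_step M
  -- Thus `F - id` climbs by one over each unit interval along a copy of `w`. As `w` is constant
  -- near `0` and `1`, the copies join smoothly and `F` is the identity near `0`; `w (1/2) = 0`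
  -- makes `1/2` a fixed point, and `w' > -1` makes `F` increasing.
  let F : ℝ → ℝ := fun x => x + (⌊x⌋ + w (x - ⌊x⌋))
  -- A floor-free formula across the integer `n`: on the left of `n` the second copy of `w` is `0`,
  -- and on the right the first copy is `1`.
  have hloc : ∀ (n : ℤ) (x : ℝ), (n : ℝ) - 1 < x → x < n + 1 →
      F x = x + (n - 1 + (w (x - n + 1) + w (x - n))) := by
    intro n x h1 h2
    rcases lt_or_ge x n with hx | hx
    · have : ⌊x⌋ = n - 1 := by
        rw [Int.floor_eq_iff]
        push_cast
        constructor <;> linarith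
      simp only [F, this, hw0 (x - n) (by linarith)]
      push_cast
      rw [show x - ((n : ℝ) - 1) = x - n + 1 by ring]
      ring
    · have : ⌊x⌋ = n := by
        rw [Int.floor_eq_iff]
        constructor <;> linarith
      simp only [F, this, hw1 (x - n + 1) (by linarith)]
      ring
  have hev : ∀ x : ℝ, ∀ n : ℤ, (n : ℝ) - 1 < x → x < n + 1 →
      F =ᶠ[nhds x] fun x => x + (n - 1 + (w (x - n + 1) + w (x - n))) := by
    intro x n h1 h2
    filter_upwards [Ioo_mem_nhds h1 h2] with y hy
    exact hloc n y hy.1 hy.2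
  have hF : ContDiff ℝ ∞ F := by
    rw [contDiff_iff_contDiffAt]
    intro x
    have h1 := Int.floor_le x
    have h2 := Int.lt_floor_add_one x
    refine ContDiffAt.congr_of_eventuallyEq ?_ (hev x ⌊x⌋ (by linarith) h2)
    refine ContDiff.contDiffAt (contDiff_id.add (contDiff_const.add ((hw.comp ?_).add (hw.comp ?_))))
    · exact (contDiff_id.sub contDiff_const).add contDiff_const
    · exact contDiff_id.sub contDiff_const
  have hwd := fun x => (hw.differentiable (by simp) x).hasDerivAt
  have hderivF : ∀ x : ℝ, ∀ n : ℤ, (n : ℝ) - 1 < x → x < n + 1 →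
      deriv F x = 1 + (deriv w (x - n + 1) + deriv w (x - n)) := by
    intro x n h1 h2
    rw [(hev x n h1 h2).deriv_eq]
    refine HasDerivAt.deriv ?_
    have hx := (hasDerivAt_id x).sub_const (n : ℝ)
    have e1 := (hwd (x - n + 1)).comp x (hx.add_const 1)
    have e2 := (hwd (x - n)).comp x hx
    convert! (hasDerivAt_id x).add ((e1.add e2).const_add ((n : ℝ) - 1)) using 1
    simp
  have hpos : ∀ x, 0 < deriv F x := by
    intro x
    have h1 := Int.floor_le x
    have h2 := Int.lt_floor_add_one x
    rw [hderivF x ⌊x⌋ (by linarith) h2]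
    have hzero : deriv w (x - ⌊x⌋ + 1) = 0 := by
      have : w =ᶠ[nhds (x - ⌊x⌋ + 1)] fun _ => 1 := by
        filter_upwards [Ioi_mem_nhds (show 3 / 4 < x - ⌊x⌋ + 1 by linarith)] with y hy
        exact hw1 y (le_of_lt hy)
      rw [this.deriv_eq, deriv_const]
    rw [hzero, zero_add]
    linarith [hw' (x - ⌊x⌋)]
  have hmono : StrictMono F := strictMono_of_deriv_pos hpos
  have hint : ∀ n : ℤ, F n = 2 * n := by
    intro n
    simp only [F, Int.floor_intCast, sub_self, hw0 0 (by norm_num)]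
    ring
  have hsurj : Function.Surjective F := by
    intro y
    have h1 : F (⌊y / 2⌋ : ℤ) ≤ y := by
      rw [hint]; linarith [Int.floor_le (y / 2)]
    have h2 : y ≤ F (⌊y / 2⌋ + 1 : ℤ) := by
      rw [hint]; push_cast; linarith [Int.lt_floor_add_one (y / 2)]
    exact mem_range_of_exists_le_of_exists_ge hF.continuous ⟨_, h1⟩ ⟨_, h2⟩
  let f : HomeoPlus := hmono.orderIsoOfSurjective F hsurj
  have hfF : (f : ℝ → ℝ) = F := rfl
  have hfl : ⌊(1 / 2 : ℝ)⌋ = 0 := by norm_num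
  have hnear : F =ᶠ[nhds 0] id := by
    filter_upwards [Ioo_mem_nhds (show (-(1 / 4) : ℝ) < 0 by norm_num)
      (show (0 : ℝ) < 1 / 4 by norm_num)] with x hx
    rw [hloc 0 x (by norm_num; linarith [hx.1]) (by norm_num; linarith [hx.2])]
    rw [hw1 _ (by norm_num; linarith [hx.1]), hw0 _ (by norm_num; linarith [hx.2])]
    simp
  refine ⟨f, ⟨fun x => ?_, ?_⟩, ⟨?_, ?_, ?_, fun k hk => ?_⟩, ?_, ?_⟩
  · simp only [hfF, F, Int.floor_add_one]
    push_cast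
    rw [add_sub_add_right_eq_sub]
    ring
  · rw [hfF]
    exact hnear.eq_of_nhds
  · exact mem_smoothHomeo_of_deriv_ne_zero hF fun x => (hpos x).ne'
  · rw [hfF]
    exact hnear.eq_of_nhds
  · rw [hfF, hnear.deriv_eq, deriv_id]
  · rw [hfF, hnear.iteratedDeriv_eq, iteratedDeriv_id_of_two_le hk]
  · simp only [hfF, F, hfl]
    norm_num at hwz ⊢
    exact hwz
  · have h1 : deriv w (1 / 2 + 1) = 0 := by
      have : w =ᶠ[nhds (1 / 2 + 1)] fun _ => 1 := by
        filter_upwards [Ioi_mem_nhds (show (3 / 4 : ℝ) < 1 / 2 + 1 by norm_num)] with y hy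
        exact hw1 y (le_of_lt hy)
      rw [this.deriv_eq, deriv_const]
    have h2 := hderivF (1 / 2) 0 (by norm_num) (by norm_num)
    rw [Int.cast_zero, sub_zero, h1] at h2
    rw [hfF, h2]
    linarith

/-! ### The two assertions. -/

theorem DiffUnit.le_of_le {r s : WithTop ℕ∞} (h : r ≤ s) : DiffUnit s ≤ DiffUnit r :=
  fun _ hg => ⟨hg.1.of_le h, hg.2.of_le h⟩

theorem mainTheorem2 :
    (∀ (f : HomeoPlus) (z : ℝ),
      (∀ x : ℝ, f (x + 1) = f x + 2) → f 0 = 0 →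
      ContDiff ℝ ∞ f → ContDiff ℝ ∞ f.symm →
      deriv f 0 = 1 → (∀ k : ℕ, 2 ≤ k → iteratedDeriv k f 0 = 0) →
      z ∈ Ioo (0 : ℝ) 1 → f z = z → 1 < deriv f z →
      ∃ θ : PL2 →* HomeoPlus,
        IsReembedding f θ ∧ Function.Injective θ ∧
        (∀ (γ : PL2) (n p q : ℤ),
          (∀ x : ℝ, (γ : HomeoPlus) x = (2 : ℝ) ^ n * x + (p : ℝ) / (2 : ℝ) ^ q) →
          θ γ = reembedAffine f n p q) ∧
        ∃ φ : ThompsonF →* DiffUnit ∞,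
          Function.Injective φ ∧
          ∀ h : ThompsonF,
            (∃ H : PL2, IsIdentityExtension h H ∧
              ∀ t : Icc (0 : ℝ) 1, (((φ h : HomeoUnit) t : Icc (0 : ℝ) 1) : ℝ) = θ H t) ∧
            HomeoUnit.deriv01 (φ h) 0 = 1 ∧ HomeoUnit.deriv01 (φ h) 1 = 1 ∧
            (h ≠ 1 → ∃ t ∈ Icc (0 : ℝ) 1,
              Real.log (deriv f z) ≤ |Real.log (HomeoUnit.deriv01 (φ h) t)|)) ∧
    (∀ (r : ℕ∞) (C : ℝ), 1 ≤ r → 0 < C →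
      ∃ φ : ThompsonF →* DiffUnit r,
        Function.Injective φ ∧
        ∀ g h : ThompsonF, g ≠ h → ∃ t ∈ Icc (0 : ℝ) 1,
          C ≤ |Real.log (HomeoUnit.deriv01 (φ g) t) - Real.log (HomeoUnit.deriv01 (φ h) t)|) := by
  constructor
  · intro f z h1 h0 hs hs' hd hflat hz hfz hfz'
    have hf : IsDegreeTwo f := ⟨h1, h0⟩
    have hsm : IsFlatSmooth f := ⟨⟨hs, hs'⟩, h0, hd, hflat⟩
    refine ⟨hf.reembedding, hf.isReembedding, hf.reembedding_injective, hf.reembedding_of_affine,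
      hf.thompsonHom hsm, hf.thompsonHom_injective hsm hz hfz hfz', fun h => ⟨?_, ?_, ?_, ?_⟩⟩
    · exact ⟨ThompsonF.toPL2 h, HomeoUnit.isIdentityExtension_extend _, fun t => rfl⟩
    · exact hf.deriv01_thompsonHom_zero hsm h
    · exact hf.deriv01_thompsonHom_one hsm h
    · exact hf.exists_log_deriv01_thompsonHom hsm hz hfz hfz'
  · intro r C _ hC
    -- One smooth `f` serves every `r`. Derivative at least `e^C` at `1/2` gives both the bound `C`
    -- on the logarithm and, since `C > 0`, the expansion at the fixed point.
    obtain ⟨f, hf, hs, hfz, hM⟩ := exists_isDegreeTwo_isFlatSmooth (Real.exp C)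
    have hz : (1 / 2 : ℝ) ∈ Ioo (0 : ℝ) 1 := by norm_num
    have hfz' : 1 < deriv f (1 / 2) := (Real.one_lt_exp_iff.2 hC).trans_le hM
    have hlog : C ≤ Real.log (deriv f (1 / 2)) :=
      (Real.le_log_iff_exp_le (zero_lt_one.trans hfz')).2 hM
    have hle : DiffUnit ∞ ≤ DiffUnit r := DiffUnit.le_of_le (by exact_mod_cast le_top)
    refine ⟨(Subgroup.inclusion hle).comp (hf.thompsonHom hs),
      (Subgroup.inclusion_injective hle).comp (hf.thompsonHom_injective hs hz hfz hfz'),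
      fun g h hgh => ?_⟩
    obtain ⟨t, ht, hlog'⟩ := hf.exists_log_deriv01_sub hs hz hfz hfz' hgh
    exact ⟨t, ht, hlog.trans hlog'⟩
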